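/- Let $g,h\in\mathbb R$, $\rho>0$, let $T\subseteq\mathbb R$ be an open set of times, and let $(\phi,p,\eta)$ be a classical solution, for $t\in T$, of the three-dimensional water-wave problem over the flat bottom $z=-h$ with fluid domain $V_t=\{-h<z<\eta(x,y,t)\}$, where $\eta(x,y,t)>-h$: $$\Delta\phi=0,\qquad \phi_t+\tfrac12|\nabla\phi|^2+gz+\tfrac p\rho=0\quad\text{in }V_t,\qquad \phi_z=0\ \text{ at } z=-h,$$ $$\eta_t+\phi_x\eta_x+\phi_y\eta_y=\phi_z,\qquad \phi_t+\tfrac12|\nabla\phi|^2+g\eta=0\quad\text{at } z=\eta(x,y,t).$$ Here $\eta$ is $C^2$ in $(x,y,t)$ and $\phi$ is $C^2$ in $(x,y,z,t)$ up to the boundary of the fluid domain, i.e. $C^2$ near every point of the closed fluid domain (in particular smooth solutions are included). Let $D$ be a nonnegative, bounded, integrable function on $\mathbb R^2$, and assume that $\phi$, $\eta$ and all their space-time derivatives of order at most two are bounded by a constant times $D(x,y)$ on the closed fluid domain, locally uniformly in $t\in T$. Write $q(x,y,t)=\phi(x,y,\eta(x,y,t),t)$ and $\nabla^\perp=(\partial_x,\partial_y)$.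 Write $\iint_{\mathcal T}$ and $\iint_{\mathcal B}$ for integrals over $(x,y)\in\mathbb R^2$ with the integrand evaluated at $z=\eta(x,y,t)$, respectively at $z=-h$; let $\vec n$ be the upward unit normal of the free surface and $dS=\sqrt{1+|\nabla\eta|^2}\,dx\,dy$. Derivatives $\psi_x,\psi_y,\psi_z,\dots$ of a function $\psi(x,y,z)$ are taken in space and then evaluated on the surface in question; $\frac{d}{dt}[\psi]$ is the time derivative of $\psi(x,y,\eta(x,y,t))$. A *test function with growth* $G:\mathbb R^2\to\mathbb R$ is a time-independent function $\psi(x,y,z)$ with complex values that is harmonic in $V_t$ for all $t\in T$, is $C^3$ near every point of the closure $\{-h\le z\le\eta\}$ for $t\in T$, and whose derivatives of orders one to three are bounded by a constant times $G(x,y)$ on that closure, locally uniformly in $t\in T$. **(1)** For every $G$ with $DG$ integrable on $\mathbb R^2$, every test function $\psi$ with growth $G$ and every $t\in T$, all integrals below converge absolutely (for $\iint_{\mathcal T}\psi_z\eta_t$ at all times near $t$), the time derivative in the second identity exists, and $$\iint_{\mathcal T}\frac{d}{dt}[\psi]\,dx\,dy=\iint_{\mathcal T}\left[q_x\psi_x+q_y\psi_y\right]dx\,dy-\iint_{\mathcal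 B}\phi\,\psi_{zz}\,dx\,dy,$$ $$\frac{d}{dt}\iint_{\mathcal T}\psi_z\eta_t\,dx\,dy-\iint_{\mathcal T}\left[q_t\nabla\psi_z+(\nabla^\perp q\cdot\nabla^\perp\psi_z)\nabla\phi\right]\cdot\vec n\,dS=-\iint_{\mathcal B}\phi_t\,\psi_{zz}\,dx\,dy.$$ If moreover $\psi(x,y,\eta(x,y,t))$ is integrable over $\mathbb R^2$ at the time $t$, then $\iint_{\mathcal T}\psi\,dx\,dy$ is differentiable at $t$ and its derivative equals the right-hand side of the first identity. **(2)** For all $t\in T$ and $(x,y)\in\mathbb R^2$ the local Ablowitz–Fokas–Musslimani (AFM) equation holds: $$q_t+\tfrac12|\nabla^\perp q|^2+g\eta-\frac12\,\frac{(\eta_t+\nabla^\perp q\cdot\nabla^\perp\eta)^2}{1+|\nabla\eta|^2}=0 .$$ The second identity in (1) also holds, with the same convergence, when $q_t$ is replaced by the expression that this equation gives for it; the first identity together with this form of the second is the nonlocal/nonlocal system. **(3)** The first identity contains the nonlocal AFM equation. For $\vec k=(k_x,k_y)\in\mathbb R^2$ the function $\psi_{\vec k}=e^{i(k_xx+k_yy)}\sinh(|\vec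 k|(z+h))$ is a test function with growth $G=1$ whose second derivative $\psi_{\vec k,zz}$ vanishes at $z=-h$. Put $$A_{\vec k}=e^{i(k_xx+k_yy)}\Big[i\eta_t\cosh(|\vec k|(\eta+h))+\frac{\vec k\cdot\nabla^\perp q}{|\vec k|}\sinh(|\vec k|(\eta+h))\Big],$$ the second term being read as $0$ for $\vec k=0$. Then, at every $(x,y)$ and every $t\in T$, $$\frac{d}{dt}[\psi_{\vec k}]-\left(q_x\psi_{\vec k,x}+q_y\psi_{\vec k,y}\right)=-i|\vec k|\,A_{\vec k}\quad\text{on } z=\eta,$$ and for all $\vec k\in\mathbb R^2$ and $t\in T$ the function $A_{\vec k}$ is integrable and $$\iint_{\mathbb R^2}A_{\vec k}\,dx\,dy=0 .$$ -/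

import Mathlib

open MeasureTheory Topology

noncomputable section

namespace WaterWave

/-! Spatial fields are written `f x y z`, surface fields `ζ x y`; a time-dependent field carries
the time as its first argument, so `φ t x y z` and `η t x y`. -/

section Partials

variable {E : Type*} [NormedAddCommGroup E] [NormedSpace ℝ E]

/-- `∂f/∂x` for a field `f (x, y, z)`. -/
def Dx (f : ℝ → ℝ → ℝ → E) (x y z : ℝ) : E := deriv (fun s => f s y z) x

/-- `∂f/∂y` for a field `f (x, y, z)`. -/
def Dy (f : ℝ → ℝ → ℝ → E) (x y z : ℝ) : E := deriv (fun s => f x s z) y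

/-- `∂f/∂z` for a field `f (x, y, z)`. -/
def Dz (f : ℝ → ℝ → ℝ → E) (x y z : ℝ) : E := deriv (fun s => f x y s) z

/-- `∂f/∂t` for a field `f (t, x, y, z)`. -/
def Dt (f : ℝ → ℝ → ℝ → ℝ → E) (t x y z : ℝ) : E := deriv (fun s => f s x y z) t

/-- The Laplacian `f_xx + f_yy + f_zz`. -/
def lap (f : ℝ → ℝ → ℝ → E) (x y z : ℝ) : E :=
  Dx (Dx f) x y z + Dy (Dy f) x y z + Dz (Dz f) x y z

/-- The gradient `(f_x, f_y, f_z)`. -/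
def grad (f : ℝ → ℝ → ℝ → E) (x y z : ℝ) : Fin 3 → E := ![Dx f x y z, Dy f x y z, Dz f x y z]

/-- `∂ζ/∂x` for a surface field `ζ (x, y)`. -/
def sDx (ζ : ℝ → ℝ → E) (x y : ℝ) : E := deriv (fun s => ζ s y) x

/-- `∂ζ/∂y` for a surface field `ζ (x, y)`. -/
def sDy (ζ : ℝ → ℝ → E) (x y : ℝ) : E := deriv (fun s => ζ x s) y

/-- `∂ζ/∂t` for a surface field `ζ (t, x, y)`. -/
def sDt (ζ : ℝ → ℝ → ℝ → E) (t x y : ℝ) : E := deriv (fun s => ζ s x y) t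

end Partials

/-- `|∇f|² = f_x² + f_y² + f_z²`. -/
def gradSq (f : ℝ → ℝ → ℝ → ℝ) (x y z : ℝ) : ℝ :=
  Dx f x y z ^ 2 + Dy f x y z ^ 2 + Dz f x y z ^ 2

/-- `(φ, p, η)` is a classical solution, on the open time set `T`, of the water-wave problem over
the flat bottom `z = -h`. The fluid domain at time `t` is `-h < z < η t x y`. Being `C²` up to the
boundary is expressed by `ContDiffAt` at every point of the closed fluid domain. -/
structure IsSolution (g h ρ : ℝ) (T : Set ℝ) (φ p : ℝ → ℝ → ℝ → ℝ → ℝ) (η : ℝ → ℝ → ℝ → ℝ) :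
    Prop where
  depth : ∀ t ∈ T, ∀ x y, -h < η t x y
  contDiff_surface : ∀ t ∈ T, ∀ x y,
    ContDiffAt ℝ 2 (fun r : ℝ × ℝ × ℝ => η r.1 r.2.1 r.2.2) (t, x, y)
  contDiff_potential : ∀ t ∈ T, ∀ x y z, -h ≤ z → z ≤ η t x y →
    ContDiffAt ℝ 2 (fun r : ℝ × ℝ × ℝ × ℝ => φ r.1 r.2.1 r.2.2.1 r.2.2.2) (t, x, y, z)
  laplace : ∀ t ∈ T, ∀ x y z, -h < z → z < η t x y → lap (φ t) x y z = 0
  bernoulli : ∀ t ∈ T, ∀ x y z, -h < z → z < η t x y →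
    Dt φ t x y z + gradSq (φ t) x y z / 2 + g * z + p t x y z / ρ = 0
  bed : ∀ t ∈ T, ∀ x y, Dz (φ t) x y (-h) = 0
  kinematic : ∀ t ∈ T, ∀ x y,
    sDt η t x y + Dx (φ t) x y (η t x y) * sDx (η t) x y + Dy (φ t) x y (η t x y) * sDy (η t) x y
      = Dz (φ t) x y (η t x y)
  dynamic : ∀ t ∈ T, ∀ x y,
    Dt φ t x y (η t x y) + gradSq (φ t) x y (η t x y) / 2 + g * η t x y = 0

/-- A horizontal decay rate: a nonnegative bounded integrable function on the `(x, y)` plane. -/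
structure IsDecayRate (D : ℝ × ℝ → ℝ) : Prop where
  nonneg : ∀ r, 0 ≤ D r
  bounded : ∃ M, ∀ r, D r ≤ M
  integrable : Integrable D

/-- `φ`, `η` and their space-time derivatives of order at most two are `O(D(x, y))` on the closed
fluid domain, locally uniformly in time. -/
structure DecaysAtRate (D : ℝ × ℝ → ℝ) (h : ℝ) (T : Set ℝ) (φ : ℝ → ℝ → ℝ → ℝ → ℝ)
    (η : ℝ → ℝ → ℝ → ℝ) : Prop where
  surface : ∀ t₀ ∈ T, ∃ C : ℝ, ∀ᶠ t in 𝓝 t₀, ∀ x y, ∀ k ≤ 2,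
    ‖iteratedFDeriv ℝ k (fun r : ℝ × ℝ × ℝ => η r.1 r.2.1 r.2.2) (t, x, y)‖ ≤ C * D (x, y)
  potential : ∀ t₀ ∈ T, ∃ C : ℝ, ∀ᶠ t in 𝓝 t₀, ∀ x y z, -h ≤ z → z ≤ η t x y → ∀ k ≤ 2,
    ‖iteratedFDeriv ℝ k (fun r : ℝ × ℝ × ℝ × ℝ => φ r.1 r.2.1 r.2.2.1 r.2.2.2) (t, x, y, z)‖
      ≤ C * D (x, y)

/-- `ψ` is a (complex-valued, time-independent) harmonic test function on the fluid domain: it is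
harmonic there, `C³` up to the boundary, and its derivatives of order one to three are
`O(G(x, y))` on the closed fluid domain, locally uniformly in time. -/
structure IsTestFunction (G : ℝ × ℝ → ℝ) (h : ℝ) (T : Set ℝ) (η : ℝ → ℝ → ℝ → ℝ)
    (ψ : ℝ → ℝ → ℝ → ℂ) : Prop where
  harmonic : ∀ t ∈ T, ∀ x y z, -h < z → z < η t x y → lap ψ x y z = 0
  contDiff : ∀ t ∈ T, ∀ x y z, -h ≤ z → z ≤ η t x y →
    ContDiffAt ℝ 3 (fun r : ℝ × ℝ × ℝ => ψ r.1 r.2.1 r.2.2) (x, y, z)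
  growth : ∀ t₀ ∈ T, ∃ C : ℝ, ∀ᶠ t in 𝓝 t₀, ∀ x y z, -h ≤ z → z ≤ η t x y →
    ∀ k, 1 ≤ k → k ≤ 3 →
      ‖iteratedFDeriv ℝ k (fun r : ℝ × ℝ × ℝ => ψ r.1 r.2.1 r.2.2) (x, y, z)‖ ≤ C * G (x, y)

/-- The surface potential `q = φ|_{z = η}`. -/
def surfPot (φ : ℝ → ℝ → ℝ → ℝ → ℝ) (η : ℝ → ℝ → ℝ → ℝ) (t x y : ℝ) : ℝ := φ t x y (η t x y)

/-- The area element `dS / (dx dy) = √(1 + |∇ζ|²)` of the graph of `ζ`. -/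
def areaElement (ζ : ℝ → ℝ → ℝ) (x y : ℝ) : ℝ := √(1 + sDx ζ x y ^ 2 + sDy ζ x y ^ 2)

/-- The upward unit normal of the graph of `ζ`. -/
def unitNormal (ζ : ℝ → ℝ → ℝ) (x y : ℝ) : Fin 3 → ℝ :=
  (areaElement ζ x y)⁻¹ • ![-sDx ζ x y, -sDy ζ x y, 1]

/-- The density with respect to `dx dy` of the flux `F · n dS` through the graph of `ζ`, where
`F x y` is the value of the vector field at the surface point above `(x, y)`. -/
def fluxDensity (ζ : ℝ → ℝ → ℝ) (F : ℝ → ℝ → Fin 3 → ℂ) (x y : ℝ) : ℂ :=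
  (∑ i, F x y i * (unitNormal ζ x y i : ℂ)) * (areaElement ζ x y : ℂ)

/-- `q_x ψ_x + q_y ψ_y` on the free surface; `ψ_x`, `ψ_y` are the partial derivatives of `ψ` in
space, evaluated at `z = η`. -/
def tangentialTerm (q η : ℝ → ℝ → ℝ) (ψ : ℝ → ℝ → ℝ → ℂ) (x y : ℝ) : ℂ :=
  ((sDx q x y : ℝ) : ℂ) * Dx ψ x y (η x y) + ((sDy q x y : ℝ) : ℂ) * Dy ψ x y (η x y)

/-- The vector field `a ∇ψ_z + (∇^⊥ q · ∇^⊥ ψ_z) ∇φ` on the free surface, `∇^⊥ = (∂_x, ∂_y)`. -/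
def secondField (a q η : ℝ → ℝ → ℝ) (φ : ℝ → ℝ → ℝ → ℝ) (ψ : ℝ → ℝ → ℝ → ℂ) (x y : ℝ) :
    Fin 3 → ℂ := fun i =>
  (a x y : ℂ) * grad (Dz ψ) x y (η x y) i
    + tangentialTerm q η (Dz ψ) x y * ((grad φ x y (η x y) i : ℝ) : ℂ)

/-- The value of `q_t` prescribed by the local equation of Ablowitz, Fokas and Musslimani. -/
def localRhs (g : ℝ) (q η : ℝ → ℝ → ℝ → ℝ) (t x y : ℝ) : ℝ :=
  -((sDx (q t) x y ^ 2 + sDy (q t) x y ^ 2) / 2) - g * η t x y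
    + (sDt η t x y + (sDx (q t) x y * sDx (η t) x y + sDy (q t) x y * sDy (η t) x y)) ^ 2
      / (1 + (sDx (η t) x y ^ 2 + sDy (η t) x y ^ 2)) / 2

/-- The first integral equation at time `t`, with all its integrals absolutely convergent:
`∬_T d/dt[ψ] = ∬_T (q_x ψ_x + q_y ψ_y) - ∬_B φ ψ_zz`. -/
def FirstEq (h : ℝ) (φ : ℝ → ℝ → ℝ → ℝ → ℝ) (η : ℝ → ℝ → ℝ → ℝ) (ψ : ℝ → ℝ → ℝ → ℂ) (t : ℝ) :
    Prop :=
  Integrable (fun r : ℝ × ℝ => deriv (fun s => ψ r.1 r.2 (η s r.1 r.2)) t) ∧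
  Integrable (fun r : ℝ × ℝ => tangentialTerm (surfPot φ η t) (η t) ψ r.1 r.2) ∧
  Integrable (fun r : ℝ × ℝ => (φ t r.1 r.2 (-h) : ℂ) * Dz (Dz ψ) r.1 r.2 (-h)) ∧
  ∫ r : ℝ × ℝ, deriv (fun s => ψ r.1 r.2 (η s r.1 r.2)) t
    = (∫ r : ℝ × ℝ, tangentialTerm (surfPot φ η t) (η t) ψ r.1 r.2)
      - ∫ r : ℝ × ℝ, (φ t r.1 r.2 (-h) : ℂ) * Dz (Dz ψ) r.1 r.2 (-h)

/-- The second integral equation at time `t`, with all its integrals absolutely convergent: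
`d/dt ∬_T ψ_z η_t - ∬_T [a ∇ψ_z + (∇^⊥ q · ∇^⊥ ψ_z) ∇φ] · n dS = - ∬_B φ_t ψ_zz`,
where `a` stands for `q_t` or for an expression replacing it. -/
def SecondEq (h : ℝ) (φ : ℝ → ℝ → ℝ → ℝ → ℝ) (η : ℝ → ℝ → ℝ → ℝ) (a : ℝ → ℝ → ℝ → ℝ)
    (ψ : ℝ → ℝ → ℝ → ℂ) (t : ℝ) : Prop :=
  (∀ᶠ s in 𝓝 t,
    Integrable (fun r : ℝ × ℝ => Dz ψ r.1 r.2 (η s r.1 r.2) * ((sDt η s r.1 r.2 : ℝ) : ℂ))) ∧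
  Integrable (fun r : ℝ × ℝ =>
    fluxDensity (η t) (secondField (a t) (surfPot φ η t) (η t) (φ t) ψ) r.1 r.2) ∧
  Integrable (fun r : ℝ × ℝ => ((Dt φ t r.1 r.2 (-h) : ℝ) : ℂ) * Dz (Dz ψ) r.1 r.2 (-h)) ∧
  ∃ R : ℂ,
    HasDerivAt
      (fun s => ∫ r : ℝ × ℝ, Dz ψ r.1 r.2 (η s r.1 r.2) * ((sDt η s r.1 r.2 : ℝ) : ℂ)) R t ∧
    R - ∫ r : ℝ × ℝ,
        fluxDensity (η t) (secondField (a t) (surfPot φ η t) (η t) (φ t) ψ) r.1 r.2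
      = - ∫ r : ℝ × ℝ, ((Dt φ t r.1 r.2 (-h) : ℝ) : ℂ) * Dz (Dz ψ) r.1 r.2 (-h)

/-- The length of the wave vector `(k, l)`. -/
def waveNumber (k l : ℝ) : ℝ := √(k ^ 2 + l ^ 2)

/-- The integrand of the nonlocal equation of Ablowitz, Fokas and Musslimani for the wave vector
`(k, l)`. At `(k, l) = 0` its second term is `0`, which is also its limit. -/
def afmIntegrand (h : ℝ) (q η : ℝ → ℝ → ℝ → ℝ) (k l t x y : ℝ) : ℂ :=
  Complex.exp (Complex.I * ((k * x + l * y : ℝ) : ℂ)) *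
    (Complex.I * ((sDt η t x y : ℝ) : ℂ) * (Real.cosh (waveNumber k l * (η t x y + h)) : ℂ)
      + (((k * sDx (q t) x y + l * sDy (q t) x y) / waveNumber k l
          * Real.sinh (waveNumber k l * (η t x y + h)) : ℝ) : ℂ))

/-- The test function `e^{i(kx + ly)} sinh(|(k, l)| (z + h))`. -/
def afmTest (h k l x y z : ℝ) : ℂ :=
  Complex.exp (Complex.I * ((k * x + l * y : ℝ) : ℂ)) *
    (Real.sinh (waveNumber k l * (z + h)) : ℂ)

end WaterWave

end

/-!
The two integral equations come from Green's second identity for the potential `φ` and the harmonic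
function `ψ_z` on the fluid layer, followed by integrations by parts in the horizontal plane.

With `N = (-η_x, -η_y, 1)` the kinematic condition says `N · ∇φ = η_t` on the free surface, so
Green's identity (`Flow.green`) reads
`∬_T ψ_z η_t = ∬ q ν - ∬_B φ ψ_zz`, where `ν = N · ∇ψ_z` on the free surface (`normalTrace`);
the condition `φ_z = 0` on the bed removes the remaining bottom term.

* Since `ψ` is harmonic, `ν` is minus the horizontal divergence of the traces of `(ψ_x, ψ_y)`
  (`Flow.normalTrace_eq`). Integrating `∬ q ν` by parts gives the first equation.
* Differentiating Green's identity in time gives the second equation. Interchanging derivatives in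
  the formula for `ν` shows that `ν_t` is minus the horizontal divergence of the traces of
  `η_t (ψ_xz, ψ_yz)` (`Flow.dir_normalTrace`), and `∬ q ν_t` is again integrated by parts. This way
  only two derivatives of `φ` up to the boundary are needed, although `φ_t` enters the result.

Green's identity rests on the divergence theorem for a layer under a graph
(`integral_flux_layer`). It is proved by flattening the layer to a slab `0 ≤ s ≤ 1`: the flux of the
Piola transform of a solenoidal field through `s = const` has zero `s`-derivative. The slab has the
same shape as space-time, a real parameter together with a point of the plane, so the same three
facts about dominated fields serve throughout: horizontal derivatives integrate to zero
(`Dominated.integral_dir_e₂`, `Dominated.integral_dir_e₃`), and the parameter may be differentiated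
under the integral sign (`Dominated.hasDerivAt_integral`).

The local equation is algebra with the chain rule. The nonlocal equation is the first equation for
`afmTest` divided by `-i |k|`; for `k = 0` it is conservation of mass, the first equation for the
test function `ψ = z`.
-/

open MeasureTheory Topology

namespace WaterWave


/-! ### Directional derivatives -/

section Dir

variable {X Y F : Type*} [NormedAddCommGroup X] [NormedSpace ℝ X] [NormedAddCommGroup Y]
  [NormedSpace ℝ Y] [NormedAddCommGroup F] [NormedSpace ℝ F]

/-- The derivative of `f` at `r` in the constant direction `v`. -/
noncomputable def dir (v : X) (f : X → F) (r : X) : F := fderiv ℝ f r v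

theorem _root_.ContDiffAt.dir {n m : WithTop ℕ∞} {f : X → F} {r : X} (hf : ContDiffAt ℝ n f r)
    (hmn : m + 1 ≤ n) (v : X) : ContDiffAt ℝ m (dir v f) r :=
  (hf.fderiv_right hmn).clm_apply contDiffAt_const

theorem dir_congr {f g : X → F} {r : X} (h : f =ᶠ[𝓝 r] g) (v : X) : dir v f r = dir v g r := by
  rw [dir, dir, h.fderiv_eq]

theorem dir_comm {f : X → F} {r : X} (hf : ContDiffAt ℝ 2 f r) (v w : X) :
    dir v (dir w f) r = dir w (dir v f) r := by
  have h1 : DifferentiableAt ℝ (fderiv ℝ f) r :=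
    (hf.fderiv_right (m := 1) (by norm_num)).differentiableAt (by norm_num)
  have key : ∀ a b : X, dir a (dir b f) r = fderiv ℝ (fderiv ℝ f) r a b := by
    intro a b
    have := (h1.hasFDerivAt.clm_apply (hasFDerivAt_const b r)).fderiv
    rw [dir]
    change fderiv ℝ (fun y => fderiv ℝ f y b) r a = _
    rw [this]
    simp
  rw [key, key]
  exact (hf.isSymmSndFDerivAt (by simp)).eq v w

theorem dir_smul {f : X → ℝ} {g : X → F} {r : X} (hf : DifferentiableAt ℝ f r)
    (hg : DifferentiableAt ℝ g r) (v : X) :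
    dir v (fun r => f r • g r) r = f r • dir v g r + dir v f r • g r := by
  simp only [dir]
  rw [fderiv_fun_smul hf hg]
  simp

theorem dir_add {f g : X → F} {r : X} (hf : DifferentiableAt ℝ f r)
    (hg : DifferentiableAt ℝ g r) (v : X) :
    dir v (fun r => f r + g r) r = dir v f r + dir v g r := by
  simp only [dir]
  rw [fderiv_fun_add hf hg]
  simp

theorem dir_sub {f g : X → F} {r : X} (hf : DifferentiableAt ℝ f r)
    (hg : DifferentiableAt ℝ g r) (v : X) :
    dir v (fun r => f r - g r) r = dir v f r - dir v g r := by
  simp only [dir]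
  rw [fderiv_fun_sub hf hg]
  simp

theorem dir_comp {f : X → F} {g : Y → X} {r : Y} (hf : DifferentiableAt ℝ f (g r))
    (hg : DifferentiableAt ℝ g r) (v : Y) :
    dir v (fun r => f (g r)) r = fderiv ℝ f (g r) (dir v g r) := by
  simp only [dir]
  rw [show (fun r => f (g r)) = f ∘ g from rfl, fderiv_comp r hf hg]
  simp

theorem dir_prodMk {f : X → F} {g : X → Y} {r : X} (hf : DifferentiableAt ℝ f r)
    (hg : DifferentiableAt ℝ g r) (v : X) :
    dir v (fun r => (f r, g r)) r = (dir v f r, dir v g r) := by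
  simp only [dir]
  rw [(hf.hasFDerivAt.prodMk hg.hasFDerivAt).fderiv]
  simp

theorem norm_iteratedFDeriv_dir_le {n : WithTop ℕ∞} {f : X → F} {r : X}
    (hf : ContDiffAt ℝ n f r) (v : X) {k : ℕ} (hk : (k : WithTop ℕ∞) + 1 ≤ n) :
    ‖iteratedFDeriv ℝ k (dir v f) r‖ ≤ ‖v‖ * ‖iteratedFDeriv ℝ (k + 1) f r‖ := by
  rw [← norm_iteratedFDeriv_fderiv]
  exact norm_iteratedFDeriv_clm_apply_const (hf.fderiv_right hk) le_rfl

end Dir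

/-! ### Functions of class `C¹` dominated by a weight -/

theorem exists_bound_of_le {X : Type*} {S : Set X} {w w' : X → ℝ} {N : X → ℝ}
    (hN : ∃ K : ℝ, ∀ r ∈ S, N r ≤ K * w r)
    {M : ℝ} (hw : ∀ r ∈ S, |w r| ≤ M * w' r) :
    ∃ K : ℝ, ∀ r ∈ S, N r ≤ K * w' r := by
  obtain ⟨K, hK⟩ := hN
  refine ⟨|K| * M, fun r hr => ?_⟩
  calc N r ≤ |K * w r| := (hK r hr).trans (le_abs_self _)
    _ = |K| * |w r| := abs_mul _ _
    _ ≤ |K| * (M * w' r) := by gcongr; exact hw r hr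
    _ = _ := by ring

section Dominated

variable {X Y F H : Type*} [NormedAddCommGroup X] [NormedSpace ℝ X] [NormedAddCommGroup Y]
  [NormedSpace ℝ Y] [NormedAddCommGroup F] [NormedSpace ℝ F] [NormedAddCommGroup H]
  [NormedSpace ℝ H]

/-- `f` is `C¹` near every point of `S`, with first derivative `O(w)` on `S`. -/
structure DerivDominated (S : Set X) (w : X → ℝ) (f : X → F) : Prop where
  contDiffAt : ∀ r ∈ S, ContDiffAt ℝ 1 f r
  bound_fderiv : ∃ K : ℝ, ∀ r ∈ S, ‖fderiv ℝ f r‖ ≤ K * w r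

/-- `f` is `C¹` near every point of `S`; both `f` and its first derivative are `O(w)` on `S`. -/
structure Dominated (S : Set X) (w : X → ℝ) (f : X → F) : Prop extends DerivDominated S w f where
  bound : ∃ K : ℝ, ∀ r ∈ S, ‖f r‖ ≤ K * w r

variable {S : Set X} {w w' : X → ℝ} {f g : X → F}

theorem DerivDominated.differentiableAt (hf : DerivDominated S w f) {r : X} (hr : r ∈ S) :
    DifferentiableAt ℝ f r := (hf.contDiffAt r hr).differentiableAt (by norm_num)

theorem DerivDominated.mono (hf : DerivDominated S w f) {S' : Set X} (h : S' ⊆ S) :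
    DerivDominated S' w f :=
  ⟨fun r hr => hf.contDiffAt r (h hr), hf.bound_fderiv.imp fun _ hK r hr => hK r (h hr)⟩

theorem Dominated.mono (hf : Dominated S w f) {S' : Set X} (h : S' ⊆ S) : Dominated S' w f :=
  ⟨hf.toDerivDominated.mono h, hf.bound.imp fun _ hK r hr => hK r (h hr)⟩

theorem Dominated.weaken (hf : Dominated S w f) {M : ℝ} (hw : ∀ r ∈ S, |w r| ≤ M * w' r) :
    Dominated S w' f :=
  ⟨⟨hf.contDiffAt, exists_bound_of_le hf.bound_fderiv hw⟩,
    exists_bound_of_le hf.bound hw⟩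

theorem Dominated.congr (hf : Dominated S w f) (h : ∀ r ∈ S, g =ᶠ[𝓝 r] f) : Dominated S w g := by
  refine ⟨⟨fun r hr => (hf.contDiffAt r hr).congr_of_eventuallyEq (h r hr), ?_⟩, ?_⟩
  · obtain ⟨K, hK⟩ := hf.bound_fderiv
    exact ⟨K, fun r hr => by rw [(h r hr).fderiv_eq]; exact hK r hr⟩
  · obtain ⟨K, hK⟩ := hf.bound
    exact ⟨K, fun r hr => by rw [(h r hr).eq_of_nhds]; exact hK r hr⟩

theorem Dominated.add (hf : Dominated S w f) (hg : Dominated S w g) :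
    Dominated S w (fun r => f r + g r) := by
  obtain ⟨K, hK⟩ := hf.bound
  obtain ⟨L, hL⟩ := hg.bound
  obtain ⟨K', hK'⟩ := hf.bound_fderiv
  obtain ⟨L', hL'⟩ := hg.bound_fderiv
  refine ⟨⟨fun r hr => (hf.contDiffAt r hr).add (hg.contDiffAt r hr), K' + L', fun r hr => ?_⟩,
    K + L, fun r hr => ?_⟩
  · rw [fderiv_fun_add (hf.differentiableAt hr) (hg.differentiableAt hr), add_mul]
    exact (norm_add_le _ _).trans (add_le_add (hK' r hr) (hL' r hr))
  · rw [add_mul]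
    exact (norm_add_le _ _).trans (add_le_add (hK r hr) (hL r hr))

theorem Dominated.neg (hf : Dominated S w f) : Dominated S w (fun r => -f r) := by
  refine ⟨⟨fun r hr => (hf.contDiffAt r hr).neg, ?_⟩, ?_⟩
  · obtain ⟨K, hK⟩ := hf.bound_fderiv
    exact ⟨K, fun r hr => by rw [fderiv_fun_neg, norm_neg]; exact hK r hr⟩
  · obtain ⟨K, hK⟩ := hf.bound
    exact ⟨K, fun r hr => by rw [norm_neg]; exact hK r hr⟩

theorem Dominated.sub (hf : Dominated S w f) (hg : Dominated S w g) :
    Dominated S w (fun r => f r - g r) := by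
  simpa only [sub_eq_add_neg] using hf.add hg.neg

theorem Dominated.smul {c : X → ℝ} (hc : Dominated S w c) (hf : Dominated S w' f) :
    Dominated S (fun r => w r * w' r) (fun r => c r • f r) := by
  obtain ⟨K, hK⟩ := hc.bound
  obtain ⟨L, hL⟩ := hf.bound
  obtain ⟨K', hK'⟩ := hc.bound_fderiv
  obtain ⟨L', hL'⟩ := hf.bound_fderiv
  have key : ∀ {a b A B u v : ℝ}, 0 ≤ a → 0 ≤ b → a ≤ A * u → b ≤ B * v →
      a * b ≤ A * B * (u * v) := by
    intro a b A B u v ha hb h1 h2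
    calc a * b ≤ (A * u) * (B * v) := mul_le_mul h1 h2 hb (ha.trans h1)
      _ = _ := by ring
  refine ⟨⟨fun r hr => (hc.contDiffAt r hr).smul (hf.contDiffAt r hr), K * L' + K' * L,
    fun r hr => ?_⟩, K * L, fun r hr => ?_⟩
  · rw [fderiv_fun_smul (hc.differentiableAt hr) (hf.differentiableAt hr), add_mul]
    refine (norm_add_le _ _).trans (add_le_add ?_ ?_)
    · rw [norm_smul]
      exact key (norm_nonneg _) (norm_nonneg _) (hK r hr) (hL' r hr)
    · rw [ContinuousLinearMap.norm_smulRight_apply]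
      exact key (norm_nonneg _) (norm_nonneg _) (hK' r hr) (hL r hr)
  · rw [norm_smul]
    exact key (norm_nonneg _) (norm_nonneg _) (hK r hr) (hL r hr)

theorem DerivDominated.prodMk {f : X → F} {g : X → H} (hf : DerivDominated S w f)
    (hg : DerivDominated S w g) : DerivDominated S w (fun r => (f r, g r)) := by
  obtain ⟨K, hK⟩ := hf.bound_fderiv
  obtain ⟨L, hL⟩ := hg.bound_fderiv
  refine ⟨fun r hr => (hf.contDiffAt r hr).prodMk (hg.contDiffAt r hr), K + L, fun r hr => ?_⟩
  rw [((hf.differentiableAt hr).hasFDerivAt.prodMk (hg.differentiableAt hr).hasFDerivAt).fderiv,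
    ContinuousLinearMap.opNorm_prod, add_mul, Prod.norm_def]
  refine max_le ?_ ?_
  · have := (norm_nonneg _).trans (hL r hr)
    have := hK r hr
    linarith
  · have := (norm_nonneg _).trans (hK r hr)
    have := hL r hr
    linarith

theorem derivDominated_const (c : F) : DerivDominated S w (fun _ => c) :=
  ⟨fun _ _ => contDiffAt_const, 0, fun r _ => by simp⟩

theorem derivDominated_clm (L : X →L[ℝ] F) : DerivDominated S (fun _ => (1 : ℝ)) L :=
  ⟨fun _ _ => L.contDiff.contDiffAt, ‖L‖, fun r _ => by simp⟩

theorem Dominated.comp (hf : Dominated S w f) {R : Set Y} {g : Y → X}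
    (hg : DerivDominated R (fun _ => (1 : ℝ)) g) (hgS : ∀ r ∈ R, g r ∈ S) :
    Dominated R (fun r => w (g r)) (fun r => f (g r)) := by
  obtain ⟨K, hK⟩ := hf.bound
  obtain ⟨K', hK'⟩ := hf.bound_fderiv
  obtain ⟨L, hL⟩ := hg.bound_fderiv
  refine ⟨⟨fun r hr => (hf.contDiffAt _ (hgS r hr)).comp r (hg.contDiffAt r hr), K' * L,
    fun r hr => ?_⟩, K, fun r hr => hK _ (hgS r hr)⟩
  rw [show (fun r => f (g r)) = f ∘ g from rfl,
    fderiv_comp r (hf.differentiableAt (hgS r hr)) (hg.differentiableAt hr)]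
  refine (ContinuousLinearMap.opNorm_comp_le _ _).trans ?_
  have h1 := hK' _ (hgS r hr)
  have h2 := hL r hr
  calc _ ≤ (K' * w (g r)) * (L * 1) := mul_le_mul h1 h2 (norm_nonneg _) ((norm_nonneg _).trans h1)
    _ = _ := by ring

theorem Dominated.of_iteratedFDeriv (hf : ∀ r ∈ S, ContDiffAt ℝ 1 f r)
    (hb : ∀ k ≤ 1, ∃ K : ℝ, ∀ r ∈ S, ‖iteratedFDeriv ℝ k f r‖ ≤ K * w r) : Dominated S w f := by
  refine ⟨⟨hf, ?_⟩, ?_⟩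
  · simpa only [norm_iteratedFDeriv_one] using hb 1 le_rfl
  · simpa only [norm_iteratedFDeriv_zero] using hb 0 zero_le_one

theorem exists_bound_iteratedFDeriv_dir {n : WithTop ℕ∞} (hf : ∀ r ∈ S, ContDiffAt ℝ n f r)
    {k : ℕ} (hk : (k : WithTop ℕ∞) + 1 ≤ n)
    (hb : ∃ K : ℝ, ∀ r ∈ S, ‖iteratedFDeriv ℝ (k + 1) f r‖ ≤ K * w r) (v : X) :
    ∃ K : ℝ, ∀ r ∈ S, ‖iteratedFDeriv ℝ k (dir v f) r‖ ≤ K * w r := by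
  obtain ⟨K, hK⟩ := hb
  refine ⟨‖v‖ * K, fun r hr => (norm_iteratedFDeriv_dir_le (hf r hr) v hk).trans ?_⟩
  rw [mul_assoc]
  exact mul_le_mul_of_nonneg_left (hK r hr) (norm_nonneg _)

/-- A directional derivative of a `C²` function is dominated by a weight that dominates the first
and second derivatives of the function. -/
theorem Dominated.dir_of_iteratedFDeriv (hf : ∀ r ∈ S, ContDiffAt ℝ 2 f r)
    (hb : ∀ k, 1 ≤ k → k ≤ 2 → ∃ K : ℝ, ∀ r ∈ S, ‖iteratedFDeriv ℝ k f r‖ ≤ K * w r) (v : X) :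
    Dominated S w (dir v f) := by
  refine .of_iteratedFDeriv (fun r hr => (hf r hr).dir (by norm_num) v) fun k hk => ?_
  refine exists_bound_iteratedFDeriv_dir hf ?_ (hb (k + 1) (by omega) (by omega)) v
  interval_cases k <;> norm_num

end Dominated

/-! ### Integrals over the plane of dominated fields -/

section Plane

variable {F : Type*} [NormedAddCommGroup F] [NormedSpace ℝ F]

/-- The first basis vector of `ℝ³`: the `t` direction for coordinates `(t, x, y)`, the `x`
direction for coordinates `(x, y, z)`. -/
def e₁ : ℝ × ℝ × ℝ := (1, 0, 0)

/-- The second basis vector of `ℝ³`. -/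
def e₂ : ℝ × ℝ × ℝ := (0, 1, 0)

/-- The third basis vector of `ℝ³`. -/
def e₃ : ℝ × ℝ × ℝ := (0, 0, 1)

theorem clm_apply_triple (L : ℝ × ℝ × ℝ →L[ℝ] F) (a b c : ℝ) :
    L (a, b, c) = a • L e₁ + b • L e₂ + c • L e₃ := by
  rw [← map_smul, ← map_smul, ← map_smul, ← map_add, ← map_add]
  simp [e₁, e₂, e₃]

theorem hasDerivAt_curve {X : Type*} [NormedAddCommGroup X] [NormedSpace ℝ X] {f : X → F}
    {c : ℝ → X} {s : ℝ} {v : X} (hf : DifferentiableAt ℝ f (c s)) (hc : HasDerivAt c v s) :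
    HasDerivAt (fun u => f (c u)) (dir v f (c s)) s :=
  hf.hasFDerivAt.comp_hasDerivAt s hc

theorem hasDerivAt_fst (a : ℝ) (b : ℝ × ℝ) :
    HasDerivAt (fun s : ℝ => (s, b)) (1, 0, 0) a :=
  (hasDerivAt_id a).prodMk (hasDerivAt_const a b)

theorem hasDerivAt_snd (a b c : ℝ) :
    HasDerivAt (fun s : ℝ => ((a, s, c) : ℝ × ℝ × ℝ)) (0, 1, 0) b := by
  simpa using (hasDerivAt_const b a).prodMk ((hasDerivAt_id b).prodMk (hasDerivAt_const b c))

theorem hasDerivAt_thd (a b c : ℝ) :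
    HasDerivAt (fun s : ℝ => ((a, b, s) : ℝ × ℝ × ℝ)) (0, 0, 1) c := by
  simpa using (hasDerivAt_const c a).prodMk ((hasDerivAt_const c b).prodMk (hasDerivAt_id c))

/-- The integral over the plane of an `x`-derivative vanishes: by Fubini's theorem it suffices to
integrate along almost every line parallel to the `x`-axis. -/
theorem integral_partial_fst_eq_zero {f f' : ℝ × ℝ → F} (hf : Integrable f) (hf' : Integrable f')
    (hd : ∀ x y, HasDerivAt (fun s => f (s, y)) (f' (x, y)) x) : ∫ r, f' r = 0 := by
  rw [Measure.volume_eq_prod] at hf hf' ⊢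
  rw [integral_prod_symm _ hf']
  refine integral_eq_zero_of_ae ?_
  filter_upwards [hf.prod_left_ae, hf'.prod_left_ae] with y h h'
  exact integral_eq_zero_of_hasDerivAt_of_integrable (fun x => hd x y) h' h

theorem integral_partial_snd_eq_zero {f f' : ℝ × ℝ → F} (hf : Integrable f) (hf' : Integrable f')
    (hd : ∀ x y, HasDerivAt (fun s => f (x, s)) (f' (x, y)) y) : ∫ r, f' r = 0 := by
  rw [Measure.volume_eq_prod] at hf hf' ⊢
  rw [integral_prod _ hf']
  refine integral_eq_zero_of_ae ?_
  filter_upwards [hf.prod_right_ae, hf'.prod_right_ae] with x h h'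
  exact integral_eq_zero_of_hasDerivAt_of_integrable (fun y => hd x y) h' h

variable {U : Set ℝ} {w : ℝ × ℝ → ℝ} {f : ℝ × ℝ × ℝ → F}

theorem Dominated.aestronglyMeasurable (hf : Dominated (U ×ˢ Set.univ) (fun r => w r.2) f) {t : ℝ}
    (ht : t ∈ U) : AEStronglyMeasurable (fun p : ℝ × ℝ => f (t, p)) := by
  refine Continuous.aestronglyMeasurable (continuous_iff_continuousAt.2 fun p => ?_)
  exact (hf.contDiffAt (t, p) ⟨ht, trivial⟩).continuousAt.comp
    (f := fun p : ℝ × ℝ => (t, p)) (by fun_prop)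

theorem Dominated.aestronglyMeasurable_dir
    (hf : Dominated (U ×ˢ Set.univ) (fun r => w r.2) f) {t : ℝ}
    (ht : t ∈ U) (v : ℝ × ℝ × ℝ) : AEStronglyMeasurable (fun p : ℝ × ℝ => dir v f (t, p)) := by
  refine Continuous.aestronglyMeasurable (continuous_iff_continuousAt.2 fun p => ?_)
  exact ((hf.contDiffAt (t, p) ⟨ht, trivial⟩).dir (m := 0) (by norm_num) v).continuousAt.comp
    (f := fun p : ℝ × ℝ => (t, p)) (by fun_prop)

theorem Dominated.integrable (hf : Dominated (U ×ˢ Set.univ) (fun r => w r.2) f)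
    (hw : Integrable w) {t : ℝ} (ht : t ∈ U) : Integrable (fun p : ℝ × ℝ => f (t, p)) := by
  obtain ⟨K, hK⟩ := hf.bound
  exact (hw.const_mul K).mono' (hf.aestronglyMeasurable ht)
    (.of_forall fun p => hK (t, p) ⟨ht, trivial⟩)

theorem Dominated.exists_bound_dir {X : Type*} [NormedAddCommGroup X] [NormedSpace ℝ X]
    {S : Set X} {w : X → ℝ} {f : X → F} (hf : Dominated S w f)
    (v : X) : ∃ K : ℝ, ∀ r ∈ S, ‖dir v f r‖ ≤ K * w r := by
  obtain ⟨K, hK⟩ := hf.bound_fderiv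
  refine ⟨‖v‖ * K, fun r hr => ((fderiv ℝ f r).le_opNorm v).trans ?_⟩
  rw [mul_comm, mul_assoc]
  exact mul_le_mul_of_nonneg_left (hK r hr) (norm_nonneg _)

theorem Dominated.integrable_dir (hf : Dominated (U ×ˢ Set.univ) (fun r => w r.2) f)
    (hw : Integrable w) {t : ℝ} (ht : t ∈ U) (v : ℝ × ℝ × ℝ) :
    Integrable (fun p : ℝ × ℝ => dir v f (t, p)) := by
  obtain ⟨K, hK⟩ := hf.exists_bound_dir v
  exact (hw.const_mul K).mono' (hf.aestronglyMeasurable_dir ht v)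
    (.of_forall fun p => hK (t, p) ⟨ht, trivial⟩)

theorem Dominated.integral_dir_e₂ (hf : Dominated (U ×ˢ Set.univ) (fun r => w r.2) f)
    (hw : Integrable w) {t : ℝ} (ht : t ∈ U) : ∫ p : ℝ × ℝ, dir e₂ f (t, p) = 0 :=
  integral_partial_fst_eq_zero (hf.integrable hw ht) (hf.integrable_dir hw ht e₂) fun x y =>
    hasDerivAt_curve (c := fun s => (t, s, y))
      (hf.differentiableAt (r := (t, x, y)) ⟨ht, trivial⟩) (hasDerivAt_snd t x y)

theorem Dominated.integral_dir_e₃ (hf : Dominated (U ×ˢ Set.univ) (fun r => w r.2) f)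
    (hw : Integrable w) {t : ℝ} (ht : t ∈ U) : ∫ p : ℝ × ℝ, dir e₃ f (t, p) = 0 :=
  integral_partial_snd_eq_zero (hf.integrable hw ht) (hf.integrable_dir hw ht e₃) fun x y =>
    hasDerivAt_curve (c := fun s => (t, x, s))
      (hf.differentiableAt (r := (t, x, y)) ⟨ht, trivial⟩) (hasDerivAt_thd t x y)

theorem Dominated.hasDerivAt_integral (hf : Dominated (U ×ˢ Set.univ) (fun r => w r.2) f)
    (hw : Integrable w) {t : ℝ} (ht : U ∈ 𝓝 t) :
    HasDerivAt (fun s => ∫ p : ℝ × ℝ, f (s, p)) (∫ p : ℝ × ℝ, dir e₁ f (t, p)) t := by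
  obtain ⟨K, hK⟩ := hf.exists_bound_dir e₁
  have htU := mem_of_mem_nhds ht
  refine (hasDerivAt_integral_of_dominated_loc_of_deriv_le (bound := fun p => K * w p) ht
    (Filter.eventually_of_mem ht fun s hs => hf.aestronglyMeasurable hs)
    (hf.integrable hw htU) (F' := fun s p => dir e₁ f (s, p)) (hf.aestronglyMeasurable_dir htU e₁)
    (.of_forall fun p s hs => hK (s, p) ⟨hs, trivial⟩) (hw.const_mul K)
    (.of_forall fun p s hs => ?_)).2
  exact hasDerivAt_curve (c := fun s => (s, p))
      (hf.differentiableAt (r := (s, p)) ⟨hs, trivial⟩) (hasDerivAt_fst s p)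

theorem Dominated.continuousOn_integral (hf : Dominated (U ×ˢ Set.univ) (fun r => w r.2) f)
    (hw : Integrable w) : ContinuousOn (fun s => ∫ p : ℝ × ℝ, f (s, p)) U := by
  obtain ⟨K, hK⟩ := hf.bound
  intro t ht
  refine continuousWithinAt_of_dominated (bound := fun p => K * w p) ?_ ?_ (hw.const_mul K) ?_
  · filter_upwards [self_mem_nhdsWithin] with s hs using hf.aestronglyMeasurable hs
  · filter_upwards [self_mem_nhdsWithin] with s hs using .of_forall fun p => hK (s, p) ⟨hs, trivial⟩
  · refine .of_forall fun p => ContinuousAt.continuousWithinAt ?_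
    exact (hf.contDiffAt (t, p) ⟨ht, trivial⟩).continuousAt.comp
      (f := fun s : ℝ => (s, p)) (by fun_prop)

end Plane


/-! ### The divergence theorem over a flat bottom and under a graph -/

/-- The closed region `-h ≤ z ≤ ζ (x, y)`. -/
def layer (h : ℝ) (ζ : ℝ × ℝ → ℝ) : Set (ℝ × ℝ × ℝ) :=
  {r | -h ≤ r.2.2 ∧ r.2.2 ≤ ζ (r.1, r.2.1)}

section Divergence

variable {F : Type*} [NormedAddCommGroup F] [NormedSpace ℝ F] {h : ℝ} {ζ ζx ζy : ℝ × ℝ → ℝ}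

theorem dir_fst {X Y : Type*} [NormedAddCommGroup X] [NormedSpace ℝ X] [NormedAddCommGroup Y]
    [NormedSpace ℝ Y] (v r : X × Y) : dir v Prod.fst r = v.1 := by
  simp [dir, fderiv_fst]

theorem dir_snd {X Y : Type*} [NormedAddCommGroup X] [NormedSpace ℝ X] [NormedAddCommGroup Y]
    [NormedSpace ℝ Y] (v r : X × Y) : dir v Prod.snd r = v.2 := by
  simp [dir, fderiv_snd]

theorem dir_snd_fst {X Y Z : Type*} [NormedAddCommGroup X] [NormedSpace ℝ X]
    [NormedAddCommGroup Y] [NormedSpace ℝ Y] [NormedAddCommGroup Z] [NormedSpace ℝ Z]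
    (v r : X × Y × Z) : dir v (fun r => r.2.1) r = v.2.1 := by
  exact congrArg (fun L => L v)
    ((ContinuousLinearMap.fst ℝ Y Z).comp (ContinuousLinearMap.snd ℝ X (Y × Z))).fderiv

theorem dir_snd_snd {X Y Z : Type*} [NormedAddCommGroup X] [NormedSpace ℝ X]
    [NormedAddCommGroup Y] [NormedSpace ℝ Y] [NormedAddCommGroup Z] [NormedSpace ℝ Z]
    (v r : X × Y × Z) : dir v (fun r => r.2.2) r = v.2.2 := by
  exact congrArg (fun L => L v)
    ((ContinuousLinearMap.snd ℝ Y Z).comp (ContinuousLinearMap.snd ℝ X (Y × Z))).fderiv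

theorem derivDominated_fst {X Y : Type*} [NormedAddCommGroup X] [NormedSpace ℝ X]
    [NormedAddCommGroup Y] [NormedSpace ℝ Y] {S : Set (X × Y)} :
    DerivDominated S (fun _ => (1 : ℝ)) (fun r => r.1) :=
  derivDominated_clm (ContinuousLinearMap.fst ℝ X Y)

theorem derivDominated_snd {X Y : Type*} [NormedAddCommGroup X] [NormedSpace ℝ X]
    [NormedAddCommGroup Y] [NormedSpace ℝ Y] {S : Set (X × Y)} :
    DerivDominated S (fun _ => (1 : ℝ)) (fun r => r.2) :=
  derivDominated_clm (ContinuousLinearMap.snd ℝ X Y)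

theorem derivDominated_snd_fst {X Y Z : Type*} [NormedAddCommGroup X] [NormedSpace ℝ X]
    [NormedAddCommGroup Y] [NormedSpace ℝ Y] [NormedAddCommGroup Z] [NormedSpace ℝ Z]
    {S : Set (X × Y × Z)} : DerivDominated S (fun _ => (1 : ℝ)) (fun r => r.2.1) :=
  derivDominated_clm ((ContinuousLinearMap.fst ℝ Y Z).comp (ContinuousLinearMap.snd ℝ X (Y × Z)))

theorem derivDominated_snd_snd {X Y Z : Type*} [NormedAddCommGroup X] [NormedSpace ℝ X]
    [NormedAddCommGroup Y] [NormedSpace ℝ Y] [NormedAddCommGroup Z] [NormedSpace ℝ Z]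
    {S : Set (X × Y × Z)} : DerivDominated S (fun _ => (1 : ℝ)) (fun r => r.2.2) :=
  derivDominated_clm ((ContinuousLinearMap.snd ℝ Y Z).comp (ContinuousLinearMap.snd ℝ X (Y × Z)))

theorem Dominated.bounded_smul {X : Type*} [NormedAddCommGroup X] [NormedSpace ℝ X] {S : Set X}
    {c : X → ℝ} {f : X → F} {w : X → ℝ} (hc : Dominated S (fun _ => (1 : ℝ)) c)
    (hf : Dominated S w f) : Dominated S w (fun r => c r • f r) := by
  simpa only [one_mul] using hc.smul hf

/-- The map `(s, x, y) ↦ (x, y, -h + s (ζ + h))` of the slab `0 ≤ s ≤ 1` onto the layer. -/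
def flatten (h : ℝ) (ζ : ℝ × ℝ → ℝ) (r : ℝ × ℝ × ℝ) : ℝ × ℝ × ℝ :=
  (r.2.1, r.2.2, -h + r.1 * (ζ r.2 + h))

/-- The divergence theorem for a solenoidal field. In the coordinates of the slab the field becomes
its Piola transform, whose divergence is `ζ + h` times the divergence of the field; hence its flux
through the plane `s = const` does not depend on `s`. -/
theorem integral_flux_layer [CompleteSpace F] {w : ℝ × ℝ → ℝ} (hw : Integrable w)
    (hζ : ∀ p, -h ≤ ζ p)
    (hζ₀ : Dominated Set.univ (fun _ => (1 : ℝ)) ζ)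
    (hζ₁ : Dominated Set.univ (fun _ => (1 : ℝ)) ζx)
    (hζ₂ : Dominated Set.univ (fun _ => (1 : ℝ)) ζy)
    (hζx : ∀ p, dir (1, 0) ζ p = ζx p) (hζy : ∀ p, dir (0, 1) ζ p = ζy p)
    {F₁ F₂ F₃ : ℝ × ℝ × ℝ → F}
    (hF₁ : Dominated (layer h ζ) (fun r => w (r.1, r.2.1)) F₁)
    (hF₂ : Dominated (layer h ζ) (fun r => w (r.1, r.2.1)) F₂)
    (hF₃ : Dominated (layer h ζ) (fun r => w (r.1, r.2.1)) F₃)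
    (hdiv : ∀ r ∈ layer h ζ, dir e₁ F₁ r + dir e₂ F₂ r + dir e₃ F₃ r = 0) :
    ∫ p : ℝ × ℝ, (F₃ (p.1, p.2, ζ p) - ζx p • F₁ (p.1, p.2, ζ p) - ζy p • F₂ (p.1, p.2, ζ p))
      = ∫ p : ℝ × ℝ, F₃ (p.1, p.2, -h) := by
  set S : Set (ℝ × ℝ × ℝ) := Set.Icc (0 : ℝ) 1 ×ˢ Set.univ
  have hlift : ∀ {c : ℝ × ℝ → ℝ}, Dominated Set.univ (fun _ => (1 : ℝ)) c →
      Dominated S (fun _ => (1 : ℝ)) (fun r => c r.2) := fun hc =>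
    hc.comp derivDominated_snd fun _ _ => trivial
  have hs : Dominated S (fun _ => (1 : ℝ)) (fun r => r.1) :=
    ⟨derivDominated_fst, 1, fun r hr => by
      rw [Real.norm_eq_abs, abs_le]; constructor <;> linarith [hr.1.1, hr.1.2]⟩
  have hconst : ∀ c : ℝ, Dominated S (fun _ => (1 : ℝ)) (fun _ => c) := fun c =>
    ⟨derivDominated_const c, |c|, fun r _ => by simp⟩
  have hJ : Dominated S (fun _ => (1 : ℝ)) (fun r => ζ r.2 + h) := (hlift hζ₀).add (hconst h)
  have hΦ : DerivDominated S (fun _ => (1 : ℝ)) (flatten h ζ) :=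
    derivDominated_snd_fst.prodMk (derivDominated_snd_snd.prodMk
      ((hconst (-h)).add (Dominated.bounded_smul hs hJ)).toDerivDominated)
  have hΦS : ∀ r ∈ S, flatten h ζ r ∈ layer h ζ := by
    rintro ⟨s, p⟩ ⟨⟨h0, h1⟩, -⟩
    simp only at h0 h1
    have := hζ p
    constructor <;> simp only [flatten, Prod.mk.eta]
    · nlinarith
    · nlinarith
  have hFΦ : ∀ {f : ℝ × ℝ × ℝ → F}, Dominated (layer h ζ) (fun r => w (r.1, r.2.1)) f →
      Dominated S (fun r => w r.2) (fun r => f (flatten h ζ r)) := fun hf => hf.comp hΦ hΦS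
  have hsx := Dominated.bounded_smul hs (hlift hζ₁)
  have hsy := Dominated.bounded_smul hs (hlift hζ₂)
  have h1 := Dominated.bounded_smul hJ (hFΦ hF₁)
  have h2 := Dominated.bounded_smul hJ (hFΦ hF₂)
  have h3 := ((hFΦ hF₃).sub (Dominated.bounded_smul hsx (hFΦ hF₁))).sub (Dominated.bounded_smul hsy (hFΦ hF₂))
  set f₁ : ℝ × ℝ × ℝ → F := fun r => (ζ r.2 + h) • F₁ (flatten h ζ r) with hf₁
  set f₂ : ℝ × ℝ × ℝ → F := fun r => (ζ r.2 + h) • F₂ (flatten h ζ r) with hf₂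
  set f₃ : ℝ × ℝ × ℝ → F := fun r => F₃ (flatten h ζ r) - (r.1 • ζx r.2) • F₁ (flatten h ζ r)
    - (r.1 • ζy r.2) • F₂ (flatten h ζ r) with hf₃
  -- derivatives of the ingredients along the coordinate directions of the slab
  have hcd : ∀ {c : ℝ × ℝ → ℝ}, Dominated Set.univ (fun _ => (1 : ℝ)) c →
      ∀ v r, dir v (fun r : ℝ × ℝ × ℝ => c r.2) r = dir v.2 c r.2 := by
    intro c hc v r
    rw [dir_comp (g := Prod.snd) (hc.differentiableAt (Set.mem_univ _)) differentiableAt_snd,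
      dir_snd]
    rfl
  have hJd : ∀ v, ∀ r ∈ S, dir v (fun r : ℝ × ℝ × ℝ => ζ r.2 + h) r = dir v.2 ζ r.2 := by
    intro v r hr
    rw [dir_add ((hlift hζ₀).differentiableAt hr) (by fun_prop), hcd hζ₀]
    simp [dir]
  have hsd : ∀ {c : ℝ × ℝ × ℝ → ℝ}, Dominated S (fun _ => (1 : ℝ)) c → ∀ v, ∀ r ∈ S,
      dir v (fun r : ℝ × ℝ × ℝ => r.1 • c r) r = r.1 * dir v c r + v.1 * c r := by
    intro c hc v r hr
    rw [dir_smul differentiableAt_fst (hc.differentiableAt hr), dir_fst]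
    rfl
  have hΦd : ∀ v, ∀ r ∈ S, dir v (flatten h ζ) r
      = (v.2.1, v.2.2, r.1 * dir v.2 ζ r.2 + v.1 * (ζ r.2 + h)) := by
    intro v r hr
    have a1 : DifferentiableAt ℝ (fun r : ℝ × ℝ × ℝ => r.2.1) r := by fun_prop
    have a2 : DifferentiableAt ℝ (fun r : ℝ × ℝ × ℝ => r.2.2) r := by fun_prop
    have a3 := ((hconst (-h)).add (Dominated.bounded_smul hs hJ)).differentiableAt hr
    rw [show flatten h ζ = fun r => (r.2.1, r.2.2, -h + r.1 • (ζ r.2 + h)) from rfl,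
      dir_prodMk a1 (a2.prodMk a3), dir_prodMk a2 a3,
      dir_add (by fun_prop) ((Dominated.bounded_smul hs hJ).differentiableAt hr), hsd hJ v r hr, hJd v r hr,
      dir_snd_fst, dir_snd_snd]
    simp [dir]
  have hFd : ∀ {f : ℝ × ℝ × ℝ → F}, Dominated (layer h ζ) (fun r => w (r.1, r.2.1)) f →
      ∀ v, ∀ r ∈ S, dir v (fun r => f (flatten h ζ r)) r
        = v.2.1 • dir e₁ f (flatten h ζ r) + v.2.2 • dir e₂ f (flatten h ζ r)
          + (r.1 * dir v.2 ζ r.2 + v.1 * (ζ r.2 + h)) • dir e₃ f (flatten h ζ r) := by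
    intro f hf v r hr
    rw [dir_comp (hf.differentiableAt (hΦS r hr)) (hΦ.differentiableAt hr), hΦd v r hr,
      clm_apply_triple]
    rfl
  -- the Piola transform `(f₃, f₁, f₂)` is solenoidal in the coordinates `(s, x, y)`
  have hzero : ∀ r ∈ S, dir e₁ f₃ r = -(dir e₂ f₁ r + dir e₃ f₂ r) := by
    intro r hr
    have b1 := (hFΦ hF₁).differentiableAt hr
    have b2 := (hFΦ hF₂).differentiableAt hr
    have b3 := (hFΦ hF₃).differentiableAt hr
    have b4 := (Dominated.bounded_smul hsx (hFΦ hF₁)).differentiableAt hr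
    have b5 := (Dominated.bounded_smul hsy (hFΦ hF₂)).differentiableAt hr
    have b34 : DifferentiableAt ℝ
        (fun r => F₃ (flatten h ζ r) - (r.1 • ζx r.2) • F₁ (flatten h ζ r)) r := b3.sub b4
    have hd := hdiv _ (hΦS r hr)
    have hd' := eq_neg_of_add_eq_zero_right hd
    rw [hf₁, hf₂, hf₃, dir_sub b34 b5, dir_sub b3 b4,
      dir_smul (hsx.differentiableAt hr) b1, dir_smul (hsy.differentiableAt hr) b2,
      dir_smul (hJ.differentiableAt hr) b1, dir_smul (hJ.differentiableAt hr) b2,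
      hsd (hlift hζ₁) _ r hr, hsd (hlift hζ₂) _ r hr, hcd hζ₁, hcd hζ₂, hJd _ r hr, hJd _ r hr,
      hFd hF₁ _ r hr, hFd hF₁ _ r hr, hFd hF₂ _ r hr, hFd hF₂ _ r hr, hFd hF₃ _ r hr]
    have z : ∀ c : ℝ × ℝ → ℝ, dir (e₁.2) c r.2 = 0 := fun c => map_zero (fderiv ℝ c r.2)
    rw [z, z, z, hd', show e₂.2 = (1, 0) from rfl, show e₃.2 = (0, 1) from rfl, hζx, hζy]
    simp only [e₁, e₂, e₃, smul_eq_mul]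
    module
  have hcont := h3.continuousOn_integral hw
  have hder : ∀ s ∈ Set.Ioo (0 : ℝ) 1, HasDerivAt (fun s => ∫ p : ℝ × ℝ, f₃ (s, p)) 0 s := by
    intro s hs'
    have hmem : s ∈ Set.Icc (0 : ℝ) 1 := Set.Ioo_subset_Icc_self hs'
    have := h3.hasDerivAt_integral hw (Icc_mem_nhds hs'.1 hs'.2)
    convert this using 1
    rw [integral_congr_ae (.of_forall fun p => hzero (s, p) ⟨hmem, trivial⟩)]
    have i1 := h1.integrable_dir hw hmem e₂
    have i2 := h2.integrable_dir hw hmem e₃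
    rw [integral_neg, integral_add i1 i2, h1.integral_dir_e₂ hw hmem,
      h2.integral_dir_e₃ hw hmem]
    simp
  -- the bounds hold only for `0 ≤ s ≤ 1`, so the derivative is available in the open interval and
  -- the endpoints are reached by continuity
  have hend := intervalIntegral.integral_eq_sub_of_hasDerivAt_of_le zero_le_one hcont hder
    (by simp)
  rw [intervalIntegral.integral_zero] at hend
  have h0 : (∫ p : ℝ × ℝ, f₃ (1, p)) = ∫ p : ℝ × ℝ, f₃ (0, p) := (sub_eq_zero.1 hend.symm)
  simpa [hf₃, flatten] using h0

/-- The Laplacian of a field on `ℝ³`. -/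
noncomputable def laplacian₃ (f : ℝ × ℝ × ℝ → F) (r : ℝ × ℝ × ℝ) : F :=
  dir e₁ (dir e₁ f) r + dir e₂ (dir e₂ f) r + dir e₃ (dir e₃ f) r

/-- Green's second identity for harmonic functions on a layer. -/
theorem integral_green_layer [CompleteSpace F] {D G : ℝ × ℝ → ℝ}
    (hDG : Integrable (fun p => D p * G p)) (hζ : ∀ p, -h ≤ ζ p)
    (hζ₀ : Dominated Set.univ (fun _ => (1 : ℝ)) ζ)
    (hζ₁ : Dominated Set.univ (fun _ => (1 : ℝ)) ζx)
    (hζ₂ : Dominated Set.univ (fun _ => (1 : ℝ)) ζy)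
    (hζx : ∀ p, dir (1, 0) ζ p = ζx p) (hζy : ∀ p, dir (0, 1) ζ p = ζy p)
    {u : ℝ × ℝ × ℝ → ℝ} {χ : ℝ × ℝ × ℝ → F}
    (hu : Dominated (layer h ζ) (fun r => D (r.1, r.2.1)) u)
    (hu' : ∀ v, Dominated (layer h ζ) (fun r => D (r.1, r.2.1)) (dir v u))
    (hχ : Dominated (layer h ζ) (fun r => G (r.1, r.2.1)) χ)
    (hχ' : ∀ v, Dominated (layer h ζ) (fun r => G (r.1, r.2.1)) (dir v χ))
    (hΔu : ∀ r ∈ layer h ζ, laplacian₃ u r = 0) (hΔχ : ∀ r ∈ layer h ζ, laplacian₃ χ r = 0) :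
    ∫ p : ℝ × ℝ, ((dir e₃ u (p.1, p.2, ζ p) - ζx p * dir e₁ u (p.1, p.2, ζ p)
          - ζy p * dir e₂ u (p.1, p.2, ζ p)) • χ (p.1, p.2, ζ p)
        - u (p.1, p.2, ζ p) • (dir e₃ χ (p.1, p.2, ζ p) - ζx p • dir e₁ χ (p.1, p.2, ζ p)
          - ζy p • dir e₂ χ (p.1, p.2, ζ p)))
      = ∫ p : ℝ × ℝ, (dir e₃ u (p.1, p.2, -h) • χ (p.1, p.2, -h)
          - u (p.1, p.2, -h) • dir e₃ χ (p.1, p.2, -h)) := by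
  have hF : ∀ v, Dominated (layer h ζ) (fun r => D (r.1, r.2.1) * G (r.1, r.2.1))
      (fun r => dir v u r • χ r - u r • dir v χ r) := fun v =>
    ((hu' v).smul hχ).sub (hu.smul (hχ' v))
  have hd : ∀ v, ∀ r ∈ layer h ζ, dir v (fun r => dir v u r • χ r - u r • dir v χ r) r
      = dir v (dir v u) r • χ r - u r • dir v (dir v χ) r := by
    intro v r hr
    have a1 := hu.differentiableAt hr
    have a2 := (hu' v).differentiableAt hr
    have a3 := hχ.differentiableAt hr
    have a4 := (hχ' v).differentiableAt hr
    have a5 := ((hu' v).smul hχ).differentiableAt hr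
    have a6 := (hu.smul (hχ' v)).differentiableAt hr
    rw [dir_sub a5 a6, dir_smul a2 a3, dir_smul a1 a4]
    abel
  have key := integral_flux_layer hDG hζ hζ₀ hζ₁ hζ₂ hζx hζy (hF e₁) (hF e₂) (hF e₃) (by
    intro r hr
    have h1 := hΔu r hr
    have h2 := hΔχ r hr
    rw [hd e₁ r hr, hd e₂ r hr, hd e₃ r hr]
    calc _ = laplacian₃ u r • χ r - u r • laplacian₃ χ r := by simp only [laplacian₃]; module
      _ = 0 := by rw [h1, h2]; simp)
  rw [← key]
  refine integral_congr_ae (.of_forall fun p => ?_)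
  simp only
  module

/-- A function continuous on a layer of positive depth that vanishes inside the layer vanishes on
the whole layer. -/
theorem eq_zero_of_eq_zero_inside {H : Type*} [NormedAddCommGroup H] {h : ℝ} {ζ : ℝ × ℝ → ℝ}
    {f : ℝ × ℝ × ℝ → H}
    (hζ : ∀ p, -h < ζ p) (hf : ∀ r ∈ layer h ζ, ContinuousAt f r)
    (h0 : ∀ r, -h < r.2.2 → r.2.2 < ζ (r.1, r.2.1) → f r = 0) : ∀ r ∈ layer h ζ, f r = 0 := by
  rintro ⟨x, y, z⟩ hr
  have hlt := hζ (x, y)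
  have : Set.EqOn (fun z => f (x, y, z)) (fun _ => 0) (Set.Icc (-h) (ζ (x, y))) := by
    refine Set.EqOn.of_subset_closure (s := Set.Ioo (-h) (ζ (x, y)))
      (fun z hz => h0 (x, y, z) hz.1 hz.2) ?_ continuousOn_const Set.Ioo_subset_Icc_self ?_
    · intro z hz
      exact ((hf (x, y, z) hz).comp (f := fun z : ℝ => (x, y, z)) (by fun_prop)).continuousWithinAt
    · rw [closure_Ioo hlt.ne]
  exact this hr

theorem continuousAt_laplacian₃ {f : ℝ × ℝ × ℝ → F} {r : ℝ × ℝ × ℝ} (hf : ContDiffAt ℝ 2 f r) :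
    ContinuousAt (laplacian₃ f) r := by
  have : ∀ v, ContinuousAt (dir v (dir v f)) r := fun v =>
    ((hf.dir (m := 1) (by norm_num) v).dir (m := 0) (by norm_num) v).continuousAt
  exact ((this e₁).add (this e₂)).add (this e₃)

/-- Near a point where the Laplacian of a `C³` function vanishes identically, its directional
derivatives are harmonic as well. -/
theorem laplacian₃_dir_eq_zero {f : ℝ × ℝ × ℝ → F} {r : ℝ × ℝ × ℝ} (hf : ContDiffAt ℝ 3 f r)
    (h0 : laplacian₃ f =ᶠ[𝓝 r] fun _ => 0) (v : ℝ × ℝ × ℝ) : laplacian₃ (dir v f) r = 0 := by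
  have hdd : ∀ a, DifferentiableAt ℝ (dir a (dir a f)) r := fun a =>
    ((hf.dir (m := 2) (by norm_num) a).dir (m := 1) (by norm_num) a).differentiableAt (by norm_num)
  have hcomm : ∀ a, dir v (dir a (dir a f)) r = dir a (dir a (dir v f)) r := by
    intro a
    rw [dir_comm (hf.dir (m := 2) (by norm_num) a)]
    refine dir_congr ?_ a
    filter_upwards [hf.eventually (by norm_num)] with r' hr'
    exact dir_comm (hr'.of_le (by norm_num)) v a
  have h1 : dir v (laplacian₃ f) r = 0 := by
    rw [dir_congr h0]
    simp [dir]
  have h2 : DifferentiableAt ℝ (fun r => dir e₁ (dir e₁ f) r + dir e₂ (dir e₂ f) r) r :=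
    (hdd e₁).add (hdd e₂)
  rw [show laplacian₃ f = fun r => dir e₁ (dir e₁ f) r + dir e₂ (dir e₂ f) r
      + dir e₃ (dir e₃ f) r from rfl, dir_add h2 (hdd e₃), dir_add (hdd e₁) (hdd e₂), hcomm, hcomm,
    hcomm] at h1
  exact h1

end Divergence


/-! ### The integral identities in a time interval -/

section Core

/-- The point of the free surface `z = E (t, x, y)` above `(x, y)` at time `t`. -/
def surf (E : ℝ × ℝ × ℝ → ℝ) (r : ℝ × ℝ × ℝ) : ℝ × ℝ × ℝ := (r.2.1, r.2.2, E r)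

/-- The point of the bottom below `(x, y)`. -/
def bottom (h : ℝ) (p : ℝ × ℝ) : ℝ × ℝ × ℝ := (p.1, p.2, -h)

/-- The space-time region occupied by the closed fluid domain at times in `U`. -/
def fluid (h : ℝ) (U : Set ℝ) (E : ℝ × ℝ × ℝ → ℝ) : Set (ℝ × ℝ × ℝ × ℝ) :=
  {r | r.1 ∈ U ∧ r.2 ∈ layer h fun p => E (r.1, p)}

/-- The region of space swept by the closed fluid domain at times in `U`. -/
def swept (h : ℝ) (U : Set ℝ) (E : ℝ × ℝ × ℝ → ℝ) : Set (ℝ × ℝ × ℝ) :=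
  {r | ∃ t ∈ U, r ∈ layer h fun p => E (t, p)}

/-- A water wave with potential `Φ` and surface elevation `E` as functions on space-time, with
bounds that are uniform in the open set `U` of times. Laplace's equation is required on the closed
fluid domain. -/
structure Flow (D : ℝ × ℝ → ℝ) (h : ℝ) (U : Set ℝ) (Φ : ℝ × ℝ × ℝ × ℝ → ℝ)
    (E : ℝ × ℝ × ℝ → ℝ) : Prop where
  isOpen : IsOpen U
  nonneg : ∀ p, 0 ≤ D p
  bounded : ∃ M, ∀ p, D p ≤ M
  depth : ∀ r ∈ U ×ˢ Set.univ, -h < E r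
  contDiffAt_elevation : ∀ r ∈ U ×ˢ Set.univ, ContDiffAt ℝ 2 E r
  elevation : Dominated (U ×ˢ Set.univ) (fun r => D r.2) E
  elevation_dir : ∀ v, Dominated (U ×ˢ Set.univ) (fun r => D r.2) (dir v E)
  potential : Dominated (fluid h U E) (fun r => D (r.2.1, r.2.2.1)) Φ
  contDiffAt_potential : ∀ r ∈ fluid h U E, ContDiffAt ℝ 2 Φ r
  potential_dir : ∀ v, Dominated (fluid h U E) (fun r => D (r.2.1, r.2.2.1)) (dir v Φ)
  laplace : ∀ t ∈ U, ∀ r ∈ layer h (fun p => E (t, p)), laplacian₃ (fun r => Φ (t, r)) r = 0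
  bed : ∀ t ∈ U, ∀ p, dir (0, e₃) Φ (t, bottom h p) = 0
  kinematic : ∀ r ∈ U ×ˢ Set.univ, dir e₁ E r
    = dir (0, e₃) Φ (r.1, surf E r) - dir e₂ E r * dir (0, e₁) Φ (r.1, surf E r)
      - dir e₃ E r * dir (0, e₂) Φ (r.1, surf E r)

/-- A harmonic test function, with bounds that are uniform in the set `U` of times. Harmonicity of
`Ψ` and of `Ψ_z` is required on the closed fluid domain. -/
structure Test (G : ℝ × ℝ → ℝ) (h : ℝ) (U : Set ℝ) (E : ℝ × ℝ × ℝ → ℝ)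
    (Ψ : ℝ × ℝ × ℝ → ℂ) : Prop where
  contDiffAt : ∀ r ∈ swept h U E, ContDiffAt ℝ 3 Ψ r
  dominated_dir : ∀ v, Dominated (swept h U E) (fun r => G (r.1, r.2.1)) (dir v Ψ)
  dominated_dir_dir : ∀ v w, Dominated (swept h U E) (fun r => G (r.1, r.2.1)) (dir v (dir w Ψ))
  harmonic : ∀ r ∈ swept h U E, laplacian₃ Ψ r = 0
  harmonic_dir : ∀ r ∈ swept h U E, laplacian₃ (dir e₃ Ψ) r = 0

variable {D G : ℝ × ℝ → ℝ} {h : ℝ} {U : Set ℝ} {Φ : ℝ × ℝ × ℝ × ℝ → ℝ} {E : ℝ × ℝ × ℝ → ℝ}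
  {Ψ : ℝ × ℝ × ℝ → ℂ}

theorem Flow.surf_mem_layer (hf : Flow D h U Φ E) {r : ℝ × ℝ × ℝ} (hr : r ∈ U ×ˢ Set.univ) :
    surf E r ∈ layer h fun p => E (r.1, p) :=
  ⟨(hf.depth r hr).le, le_rfl⟩

theorem Flow.surf_mem_swept (hf : Flow D h U Φ E) {r : ℝ × ℝ × ℝ} (hr : r ∈ U ×ˢ Set.univ) :
    surf E r ∈ swept h U E := ⟨r.1, hr.1, hf.surf_mem_layer hr⟩

theorem Flow.surf_mem_fluid (hf : Flow D h U Φ E) {r : ℝ × ℝ × ℝ} (hr : r ∈ U ×ˢ Set.univ) :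
    (r.1, surf E r) ∈ fluid h U E := ⟨hr.1, hf.surf_mem_layer hr⟩

theorem Flow.bottom_mem_layer (hf : Flow D h U Φ E) {t : ℝ} (ht : t ∈ U) (p : ℝ × ℝ) :
    bottom h p ∈ layer h fun p => E (t, p) :=
  ⟨le_rfl, (hf.depth (t, p) ⟨ht, trivial⟩).le⟩

theorem Flow.dominated_one {X F : Type*} [NormedAddCommGroup X] [NormedSpace ℝ X]
    [NormedAddCommGroup F] [NormedSpace ℝ F] (hf : Flow D h U Φ E) {S : Set X} {a : X → ℝ × ℝ}
    {f : X → F} (h : Dominated S (fun r => D (a r)) f) : Dominated S (fun _ => (1 : ℝ)) f := by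
  obtain ⟨M, hM⟩ := hf.bounded
  refine h.weaken (M := M) fun r _ => ?_
  rw [abs_of_nonneg (hf.nonneg _), mul_one]
  exact hM _

theorem Flow.derivDominated_surf (hf : Flow D h U Φ E) :
    DerivDominated (U ×ˢ Set.univ) (fun _ => (1 : ℝ)) (surf E) :=
  derivDominated_snd_fst.prodMk (derivDominated_snd_snd.prodMk
    (hf.dominated_one hf.elevation).toDerivDominated)

section Trace

variable {F : Type*} [NormedAddCommGroup F] [NormedSpace ℝ F]

/-- The trace on the free surface of a dominated function is dominated. -/
theorem Flow.dominated_comp_surf (hf : Flow D h U Φ E) {f : ℝ × ℝ × ℝ → F}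
    (h : Dominated (swept h U E) (fun r => G (r.1, r.2.1)) f) :
    Dominated (U ×ˢ Set.univ) (fun r => G r.2) (fun r => f (surf E r)) :=
  h.comp hf.derivDominated_surf fun _ hr => hf.surf_mem_swept hr

theorem dir_surf {E : ℝ × ℝ × ℝ → ℝ} {r : ℝ × ℝ × ℝ} (hE : DifferentiableAt ℝ E r)
    (v : ℝ × ℝ × ℝ) : dir v (surf E) r = (v.2.1, v.2.2, dir v E r) := by
  have a1 : DifferentiableAt ℝ (fun r : ℝ × ℝ × ℝ => r.2.1) r := by fun_prop
  have a2 : DifferentiableAt ℝ (fun r : ℝ × ℝ × ℝ => r.2.2) r := by fun_prop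
  rw [show surf E = fun r => (r.2.1, r.2.2, E r) from rfl,
    dir_prodMk a1 (a2.prodMk hE), dir_prodMk a2 hE, dir_snd_fst, dir_snd_snd]

theorem differentiableAt_surf {E : ℝ × ℝ × ℝ → ℝ} {r : ℝ × ℝ × ℝ} (hE : DifferentiableAt ℝ E r) :
    DifferentiableAt ℝ (surf E) r := by
  unfold surf
  fun_prop

theorem dir_trace {E : ℝ × ℝ × ℝ → ℝ} {f : ℝ × ℝ × ℝ → F} {r : ℝ × ℝ × ℝ}
    (hE : DifferentiableAt ℝ E r)
    (hf : DifferentiableAt ℝ f (surf E r)) (v : ℝ × ℝ × ℝ) :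
    dir v (fun r => f (surf E r)) r = v.2.1 • dir e₁ f (surf E r) + v.2.2 • dir e₂ f (surf E r)
      + dir v E r • dir e₃ f (surf E r) := by
  rw [dir_comp hf (differentiableAt_surf hE), dir_surf hE, clm_apply_triple]
  rfl

end Trace

theorem clm_apply_quadruple {F : Type*} [NormedAddCommGroup F] [NormedSpace ℝ F]
    (L : ℝ × ℝ × ℝ × ℝ →L[ℝ] F) (a b c d : ℝ) :
    L (a, b, c, d) = a • L (1, 0) + b • L (0, e₁) + c • L (0, e₂) + d • L (0, e₃) := by
  rw [← map_smul, ← map_smul, ← map_smul, ← map_smul, ← map_add, ← map_add, ← map_add]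
  simp [e₁, e₂, e₃]

/-- The trace of the potential on the free surface. -/
def trace (Φ : ℝ × ℝ × ℝ × ℝ → ℝ) (E : ℝ × ℝ × ℝ → ℝ) (r : ℝ × ℝ × ℝ) : ℝ := Φ (r.1, surf E r)

theorem dir_potential_trace {r : ℝ × ℝ × ℝ} (hE : DifferentiableAt ℝ E r)
    (hΦ : DifferentiableAt ℝ Φ (r.1, surf E r)) (v : ℝ × ℝ × ℝ) :
    dir v (trace Φ E) r = v.1 * dir (1, 0) Φ (r.1, surf E r)
      + v.2.1 * dir (0, e₁) Φ (r.1, surf E r) + v.2.2 * dir (0, e₂) Φ (r.1, surf E r)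
      + dir v E r * dir (0, e₃) Φ (r.1, surf E r) := by
  have h1 := differentiableAt_surf hE
  have h2 : DifferentiableAt ℝ (fun r : ℝ × ℝ × ℝ => r.1) r := differentiableAt_fst
  rw [show trace Φ E = fun r => Φ ((fun r => (r.1, surf E r)) r) from rfl,
    dir_comp (g := fun r => (r.1, surf E r)) hΦ (h2.prodMk h1), dir_prodMk h2 h1, dir_fst,
    dir_surf hE, clm_apply_quadruple]
  rfl

theorem Flow.dominated_trace (hf : Flow D h U Φ E) :
    Dominated (U ×ˢ Set.univ) (fun r => D r.2) (trace Φ E) :=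
  hf.potential.comp (derivDominated_fst.prodMk hf.derivDominated_surf) fun _ hr => hf.surf_mem_fluid hr

theorem dir_slice {X Y F : Type*} [NormedAddCommGroup X] [NormedSpace ℝ X]
    [NormedAddCommGroup Y] [NormedSpace ℝ Y] [NormedAddCommGroup F] [NormedSpace ℝ F]
    {f : X × Y → F} {t : X} {r : Y} (hf : DifferentiableAt ℝ f (t, r)) (v : Y) :
    dir v (fun r => f (t, r)) r = dir (0, v) f (t, r) := by
  rw [dir_comp (g := fun r => (t, r)) hf (by fun_prop),
    dir_prodMk (differentiableAt_const t) differentiableAt_fun_id]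
  simp [dir]

theorem derivDominated_slice {X Y : Type*} [NormedAddCommGroup X] [NormedSpace ℝ X]
    [NormedAddCommGroup Y] [NormedSpace ℝ Y] {S : Set Y} (t : X) :
    DerivDominated S (fun _ => (1 : ℝ)) (fun r => (t, r)) :=
  (derivDominated_const t).prodMk (derivDominated_clm (ContinuousLinearMap.id ℝ Y))

/-- `N · ∇ψ_z` on the free surface, for the upward normal `N = (-η_x, -η_y, 1)`. -/
noncomputable def normalTrace (E : ℝ × ℝ × ℝ → ℝ) (Ψ : ℝ × ℝ × ℝ → ℂ) (r : ℝ × ℝ × ℝ) : ℂ :=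
  dir e₃ (dir e₃ Ψ) (surf E r) - dir e₂ E r • dir e₁ (dir e₃ Ψ) (surf E r)
    - dir e₃ E r • dir e₂ (dir e₃ Ψ) (surf E r)

theorem Flow.dominated_normalTrace (hf : Flow D h U Φ E) (hΨ : Test G h U E Ψ) :
    Dominated (U ×ˢ Set.univ) (fun r => G r.2) (normalTrace E Ψ) :=
  ((hf.dominated_comp_surf (hΨ.dominated_dir_dir e₃ e₃)).sub
    ((hf.dominated_one (hf.elevation_dir e₂)).bounded_smul (hf.dominated_comp_surf (hΨ.dominated_dir_dir e₁ e₃)))).sub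
    ((hf.dominated_one (hf.elevation_dir e₃)).bounded_smul (hf.dominated_comp_surf (hΨ.dominated_dir_dir e₂ e₃)))

/-- By harmonicity of the test function, `N · ∇ψ_z` is a horizontal divergence. -/
theorem Flow.normalTrace_eq (hf : Flow D h U Φ E) (hΨ : Test G h U E Ψ) {r : ℝ × ℝ × ℝ}
    (hr : r ∈ U ×ˢ Set.univ) : normalTrace E Ψ r
      = -(dir e₂ (fun r => dir e₁ Ψ (surf E r)) r
        + dir e₃ (fun r => dir e₂ Ψ (surf E r)) r) := by
  have hs := hf.surf_mem_swept hr
  have hE := hf.elevation.differentiableAt hr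
  have h2 := (hΨ.contDiffAt _ hs).of_le (m := 2) (by norm_num)
  have hΔ := eq_neg_of_add_eq_zero_right (hΨ.harmonic _ hs)
  rw [dir_trace hE ((hΨ.dominated_dir e₁).differentiableAt hs),
    dir_trace hE ((hΨ.dominated_dir e₂).differentiableAt hs), normalTrace, hΔ,
    dir_comm h2 e₃ e₁, dir_comm h2 e₃ e₂]
  simp only [e₂, e₃]
  module

/-- The time derivative of `N · ∇ψ_z` is the horizontal divergence of `-η_t ∇ψ_z`. -/
theorem Flow.dir_normalTrace (hf : Flow D h U Φ E) (hΨ : Test G h U E Ψ) {r : ℝ × ℝ × ℝ}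
    (hr : r ∈ U ×ˢ Set.univ) : dir e₁ (normalTrace E Ψ) r
      = -(dir e₂ (fun r => dir e₁ E r • dir e₁ (dir e₃ Ψ) (surf E r)) r
        + dir e₃ (fun r => dir e₁ E r • dir e₂ (dir e₃ Ψ) (surf E r)) r) := by
  have hnhds : U ×ˢ Set.univ ∈ 𝓝 r := (hf.isOpen.prod isOpen_univ).mem_nhds hr
  have hα : ∀ v, ContDiffAt ℝ 2 (fun r => dir v Ψ (surf E r)) r := by
    intro v
    have hs : ContDiffAt ℝ 2 (surf E) r :=
      (contDiff_fst.comp contDiff_snd).contDiffAt.prodMk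
        ((contDiff_snd.comp contDiff_snd).contDiffAt.prodMk (hf.contDiffAt_elevation r hr))
    exact ((hΨ.contDiffAt _ (hf.surf_mem_swept hr)).dir (m := 2) (by norm_num) v).comp r hs
  have hαt : ∀ v, dir e₁ (fun r => dir v Ψ (surf E r))
      =ᶠ[𝓝 r] fun r => dir e₁ E r • dir v (dir e₃ Ψ) (surf E r) := by
    intro v
    filter_upwards [hnhds] with r' hr'
    have hs := hf.surf_mem_swept hr'
    rw [dir_trace (hf.elevation.differentiableAt hr') ((hΨ.dominated_dir v).differentiableAt hs),
      dir_comm ((hΨ.contDiffAt _ hs).of_le (by norm_num)) e₃ v]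
    simp [e₁]
  have hd : ∀ v w, DifferentiableAt ℝ (dir w fun r => dir v Ψ (surf E r)) r := fun v w =>
    ((hα v).dir (m := 1) (by norm_num) w).differentiableAt (by norm_num)
  have hd' : DifferentiableAt ℝ (fun r => dir e₂ (fun r => dir e₁ Ψ (surf E r)) r
      + dir e₃ (fun r => dir e₂ Ψ (surf E r)) r) r := (hd e₁ e₂).add (hd e₂ e₃)
  -- differentiate `ν = -(α_x + β_y)` in time, interchange derivatives, and insert `α_t`, `β_t`
  rw [dir_congr (g := fun r => (-1 : ℝ) • (dir e₂ (fun r => dir e₁ Ψ (surf E r)) r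
        + dir e₃ (fun r => dir e₂ Ψ (surf E r)) r))
      (by filter_upwards [hnhds] with r' hr'; rw [hf.normalTrace_eq hΨ hr', neg_one_smul]),
    dir_smul (differentiableAt_const _) hd',
    dir_add (hd e₁ e₂) (hd e₂ e₃), dir_comm (hα e₁), dir_comm (hα e₂),
    dir_congr (hαt e₁), dir_congr (hαt e₂)]
  have h0 : dir e₁ (fun _ : ℝ × ℝ × ℝ => (-1 : ℝ)) r = 0 := by simp [dir]
  rw [h0, zero_smul, add_zero, neg_one_smul]

/-- Green's identity for the potential and `ψ_z`, in which the kinematic condition identifies the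
normal derivative of the potential on the free surface with `η_t`. -/
theorem Flow.green (hf : Flow D h U Φ E) (hΨ : Test G h U E Ψ)
    (hDG : Integrable fun p => D p * G p) {t : ℝ} (ht : t ∈ U) :
    ∫ p : ℝ × ℝ, (dir e₁ E (t, p) • dir e₃ Ψ (surf E (t, p))
        - trace Φ E (t, p) • normalTrace E Ψ (t, p))
      = ∫ p : ℝ × ℝ, -(Φ (t, bottom h p) • dir e₃ (dir e₃ Ψ) (bottom h p)) := by
  have hsub : layer h (fun p => E (t, p)) ⊆ swept h U E := fun r hr => ⟨t, ht, hr⟩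
  have hslice : ∀ {f : ℝ × ℝ × ℝ × ℝ → ℝ},
      Dominated (fluid h U E) (fun r => D (r.2.1, r.2.2.1)) f →
      Dominated (layer h fun p => E (t, p)) (fun r => D (r.1, r.2.1)) (fun r => f (t, r)) :=
    fun hf' => hf'.comp (derivDominated_slice t) fun r hr => ⟨ht, hr⟩
  have hcut : ∀ {f : ℝ × ℝ × ℝ → ℝ}, Dominated (U ×ˢ Set.univ) (fun r => D r.2) f →
      Dominated Set.univ (fun _ => (1 : ℝ)) (fun p => f (t, p)) := fun hf' =>
    (hf.dominated_one hf').comp (derivDominated_slice t) fun p _ => ⟨ht, trivial⟩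
  have hdirE : ∀ v p, dir v (fun p => E (t, p)) p = dir (0, v) E (t, p) := fun v p =>
    dir_slice (hf.elevation.differentiableAt ⟨ht, trivial⟩) v
  have hdirΦ : ∀ v, ∀ r ∈ layer h (fun p => E (t, p)),
      dir v (fun r => Φ (t, r)) =ᶠ[𝓝 r] fun r => dir (0, v) Φ (t, r) := by
    intro v r hr
    have h1 := (hf.contDiffAt_potential (t, r) ⟨ht, hr⟩).eventually (by norm_num)
    have h2 : ContinuousAt (fun r : ℝ × ℝ × ℝ => (t, r)) r := by fun_prop
    filter_upwards [h2.eventually h1] with r' hr'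
    exact dir_slice (hr'.differentiableAt (by norm_num)) v
  have key := integral_green_layer (h := h) (ζ := fun p => E (t, p)) hDG
    (fun p => (hf.depth (t, p) ⟨ht, trivial⟩).le) (hcut hf.elevation) (hcut (hf.elevation_dir e₂))
    (hcut (hf.elevation_dir e₃)) (fun p => hdirE _ p) (fun p => hdirE _ p)
    (hslice hf.potential) (fun v => (hslice (hf.potential_dir (0, v))).congr (hdirΦ v))
    ((hΨ.dominated_dir e₃).mono hsub) (fun v => (hΨ.dominated_dir_dir v e₃).mono hsub)
    (hf.laplace t ht) (fun r hr => hΨ.harmonic_dir r (hsub hr))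
  have hL : ∀ p : ℝ × ℝ, dir e₁ E (t, p) = dir e₃ (fun r => Φ (t, r)) (p.1, p.2, E (t, p))
      - dir e₂ E (t, p) * dir e₁ (fun r => Φ (t, r)) (p.1, p.2, E (t, p))
      - dir e₃ E (t, p) * dir e₂ (fun r => Φ (t, r)) (p.1, p.2, E (t, p)) := by
    intro p
    have hs : (p.1, p.2, E (t, p)) ∈ layer h fun p => E (t, p) :=
      hf.surf_mem_layer (r := (t, p)) ⟨ht, trivial⟩
    rw [(hdirΦ e₁ _ hs).eq_of_nhds, (hdirΦ e₂ _ hs).eq_of_nhds, (hdirΦ e₃ _ hs).eq_of_nhds]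
    exact hf.kinematic (t, p) ⟨ht, trivial⟩
  refine (integral_congr_ae (.of_forall fun p => ?_)).trans (key.trans
    (integral_congr_ae (.of_forall fun p => ?_)))
  · simp only [hL p]
    rfl
  · have hs := hf.bottom_mem_layer ht p
    have h3 : dir e₃ (fun r => Φ (t, r)) (p.1, p.2, -h) = 0 :=
      (hdirΦ e₃ _ hs).eq_of_nhds.trans (hf.bed t ht p)
    simp only [h3, zero_smul, zero_sub]
    rfl

theorem Flow.dominated_bottom (hf : Flow D h U Φ E) (hΨ : Test G h U E Ψ) :
    Dominated (U ×ˢ Set.univ) (fun r => D r.2 * G r.2)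
      (fun r => Φ (r.1, bottom h r.2) • dir e₃ (dir e₃ Ψ) (bottom h r.2)) := by
  have hb : DerivDominated (U ×ˢ Set.univ) (fun _ => (1 : ℝ))
      (fun r : ℝ × ℝ × ℝ => bottom h r.2) :=
    derivDominated_snd_fst.prodMk (derivDominated_snd_snd.prodMk (derivDominated_const (-h)))
  exact (hf.potential.comp (derivDominated_fst.prodMk hb)
      fun r hr => ⟨hr.1, hf.bottom_mem_layer hr.1 r.2⟩).smul
    ((hΨ.dominated_dir_dir e₃ e₃).comp hb fun r hr => ⟨r.1, hr.1, hf.bottom_mem_layer hr.1 r.2⟩)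

theorem Flow.dominated_rate (hf : Flow D h U Φ E) (hΨ : Test G h U E Ψ) :
    Dominated (U ×ˢ Set.univ) (fun r => D r.2 * G r.2)
      (fun r => dir e₁ E r • dir e₃ Ψ (surf E r)) :=
  (hf.elevation_dir e₁).smul (hf.dominated_comp_surf (hΨ.dominated_dir e₃))

theorem Flow.dominated_trace_normalTrace (hf : Flow D h U Φ E) (hΨ : Test G h U E Ψ) :
    Dominated (U ×ˢ Set.univ) (fun r => D r.2 * G r.2)
      (fun r => trace Φ E r • normalTrace E Ψ r) :=
  hf.dominated_trace.smul (hf.dominated_normalTrace hΨ)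

/-- Green's identity as a relation between three functions of time. -/
theorem Flow.integral_rate (hf : Flow D h U Φ E) (hΨ : Test G h U E Ψ)
    (hDG : Integrable fun p => D p * G p) {t : ℝ} (ht : t ∈ U) :
    ∫ p : ℝ × ℝ, dir e₁ E (t, p) • dir e₃ Ψ (surf E (t, p))
      = (∫ p : ℝ × ℝ, trace Φ E (t, p) • normalTrace E Ψ (t, p))
        - ∫ p : ℝ × ℝ, Φ (t, bottom h p) • dir e₃ (dir e₃ Ψ) (bottom h p) := by
  have h1 := hf.green hΨ hDG ht
  rw [integral_sub ((hf.dominated_rate hΨ).integrable hDG ht)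
    ((hf.dominated_trace_normalTrace hΨ).integrable hDG ht), integral_neg] at h1
  rw [sub_eq_add_neg, ← h1]
  abel

/-- Integration by parts in the plane against the trace of the potential. -/
theorem Flow.integral_trace_mul (hf : Flow D h U Φ E) (hDG : Integrable fun p => D p * G p)
    {a b : ℝ × ℝ × ℝ → ℂ} (ha : Dominated (U ×ˢ Set.univ) (fun r => G r.2) a)
    (hb : Dominated (U ×ˢ Set.univ) (fun r => G r.2) b) {t : ℝ} (ht : t ∈ U) :
    Integrable (fun p : ℝ × ℝ => dir e₂ (trace Φ E) (t, p) • a (t, p)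
        + dir e₃ (trace Φ E) (t, p) • b (t, p)) ∧
    ∫ p : ℝ × ℝ, (dir e₂ (trace Φ E) (t, p) • a (t, p)
        + dir e₃ (trace Φ E) (t, p) • b (t, p))
      = ∫ p : ℝ × ℝ, trace Φ E (t, p) • -(dir e₂ a (t, p) + dir e₃ b (t, p)) := by
  have hq := hf.dominated_trace
  have hqa := hq.smul ha
  have hqb := hq.smul hb
  have i1 := hqa.integrable_dir hDG ht e₂
  have i2 := hqb.integrable_dir hDG ht e₃
  have hprod : ∀ v {c : ℝ × ℝ × ℝ → ℂ}, Dominated (U ×ˢ Set.univ) (fun r => G r.2) c →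
      Integrable (fun p : ℝ × ℝ => dir v (trace Φ E) (t, p) • c (t, p)) := by
    intro v c hc
    obtain ⟨K, hK⟩ := hq.exists_bound_dir v
    obtain ⟨L, hL⟩ := hc.bound
    refine (hDG.const_mul (K * L)).mono'
      ((hq.aestronglyMeasurable_dir ht v).smul (hc.aestronglyMeasurable ht))
      (.of_forall fun p => ?_)
    have h1 := hK (t, p) ⟨ht, trivial⟩
    have h2 := hL (t, p) ⟨ht, trivial⟩
    rw [norm_smul]
    calc _ ≤ (K * D p) * (L * G p) :=
          mul_le_mul h1 h2 (norm_nonneg _) ((norm_nonneg _).trans h1)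
      _ = _ := by ring
  have hi : Integrable (fun p : ℝ × ℝ => dir e₂ (trace Φ E) (t, p) • a (t, p)
      + dir e₃ (trace Φ E) (t, p) • b (t, p)) := (hprod e₂ ha).add (hprod e₃ hb)
  have i12 : Integrable (fun p : ℝ × ℝ => dir e₂ (fun r => trace Φ E r • a r) (t, p)
      + dir e₃ (fun r => trace Φ E r • b r) (t, p)) := i1.add i2
  refine ⟨hi, ?_⟩
  have hsum : ∀ p : ℝ × ℝ, trace Φ E (t, p) • -(dir e₂ a (t, p) + dir e₃ b (t, p))
      = (dir e₂ (trace Φ E) (t, p) • a (t, p)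
        + dir e₃ (trace Φ E) (t, p) • b (t, p))
        - (dir e₂ (fun r => trace Φ E r • a r) (t, p)
          + dir e₃ (fun r => trace Φ E r • b r) (t, p)) := by
    intro p
    have hr : (t, p) ∈ U ×ˢ (Set.univ : Set (ℝ × ℝ)) := ⟨ht, trivial⟩
    rw [dir_smul (hq.differentiableAt hr) (ha.differentiableAt hr),
      dir_smul (hq.differentiableAt hr) (hb.differentiableAt hr)]
    module
  rw [integral_congr_ae (.of_forall hsum), integral_sub hi i12, integral_add i1 i2,
    hqa.integral_dir_e₂ hDG ht, hqb.integral_dir_e₃ hDG ht]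
  simp

/-- The first integral equation. -/
theorem Flow.first (hf : Flow D h U Φ E) (hΨ : Test G h U E Ψ)
    (hDG : Integrable fun p => D p * G p) {t : ℝ} (ht : t ∈ U) :
    ∫ p : ℝ × ℝ, dir e₁ E (t, p) • dir e₃ Ψ (surf E (t, p))
      = (∫ p : ℝ × ℝ, (dir e₂ (trace Φ E) (t, p) • dir e₁ Ψ (surf E (t, p))
        + dir e₃ (trace Φ E) (t, p) • dir e₂ Ψ (surf E (t, p))))
        - ∫ p : ℝ × ℝ, Φ (t, bottom h p) • dir e₃ (dir e₃ Ψ) (bottom h p) := by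
  rw [hf.integral_rate hΨ hDG ht, (hf.integral_trace_mul hDG (hf.dominated_comp_surf (hΨ.dominated_dir e₁))
    (hf.dominated_comp_surf (hΨ.dominated_dir e₂)) ht).2]
  congr 1
  exact integral_congr_ae (.of_forall fun p => by
    simp only [hf.normalTrace_eq hΨ (r := (t, p)) ⟨ht, trivial⟩])

/-- The density of the flux in the second integral equation. -/
noncomputable def secondDensity (Φ : ℝ × ℝ × ℝ × ℝ → ℝ) (E : ℝ × ℝ × ℝ → ℝ)
    (Ψ : ℝ × ℝ × ℝ → ℂ) (r : ℝ × ℝ × ℝ) : ℂ :=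
  dir e₁ (trace Φ E) r • normalTrace E Ψ r
    + dir e₁ E r • (dir e₂ (trace Φ E) r • dir e₁ (dir e₃ Ψ) (surf E r)
      + dir e₃ (trace Φ E) r • dir e₂ (dir e₃ Ψ) (surf E r))

/-- The second integral equation: the time derivative of Green's identity, in which the term with
the time derivative of `N · ∇ψ_z` is integrated by parts. -/
theorem Flow.second (hf : Flow D h U Φ E) (hΨ : Test G h U E Ψ)
    (hDG : Integrable fun p => D p * G p) {t : ℝ} (ht : t ∈ U) :
    Integrable (fun p : ℝ × ℝ => secondDensity Φ E Ψ (t, p)) ∧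
    Integrable (fun p : ℝ × ℝ =>
      dir (1, 0) Φ (t, bottom h p) • dir e₃ (dir e₃ Ψ) (bottom h p)) ∧
    HasDerivAt (fun s => ∫ p : ℝ × ℝ, dir e₁ E (s, p) • dir e₃ Ψ (surf E (s, p)))
      ((∫ p : ℝ × ℝ, secondDensity Φ E Ψ (t, p))
        - ∫ p : ℝ × ℝ, dir (1, 0) Φ (t, bottom h p) • dir e₃ (dir e₃ Ψ) (bottom h p)) t := by
  have hU : U ∈ 𝓝 t := hf.isOpen.mem_nhds ht
  have hqν := hf.dominated_trace_normalTrace hΨ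
  have hB := hf.dominated_bottom hΨ
  have hE₁ := hf.dominated_one (hf.elevation_dir e₁)
  have ha := hE₁.bounded_smul (hf.dominated_comp_surf (hΨ.dominated_dir_dir e₁ e₃))
  have hb := hE₁.bounded_smul (hf.dominated_comp_surf (hΨ.dominated_dir_dir e₂ e₃))
  obtain ⟨hi, hI⟩ := hf.integral_trace_mul hDG ha hb ht
  have hmem : ∀ p : ℝ × ℝ, (t, p) ∈ U ×ˢ (Set.univ : Set (ℝ × ℝ)) := fun p => ⟨ht, trivial⟩
  have hBd : ∀ p : ℝ × ℝ, dir e₁ (fun r : ℝ × ℝ × ℝ =>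
      Φ (r.1, bottom h r.2) • dir e₃ (dir e₃ Ψ) (bottom h r.2)) (t, p)
      = dir (1, 0) Φ (t, bottom h p) • dir e₃ (dir e₃ Ψ) (bottom h p) := by
    intro p
    have hΦ := hf.potential.differentiableAt (r := (t, bottom h p)) ⟨ht, hf.bottom_mem_layer ht p⟩
    have h1 : HasDerivAt (fun s : ℝ => Φ (s, bottom h p)) (dir (1, 0) Φ (t, bottom h p)) t :=
      hasDerivAt_curve (c := fun s => (s, bottom h p)) hΦ
        ((hasDerivAt_id t).prodMk (hasDerivAt_const t _))
    have h2 := hasDerivAt_curve (c := fun s => (s, p)) (hB.differentiableAt (hmem p))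
      (hasDerivAt_fst t p)
    exact h2.unique (h1.smul_const (dir e₃ (dir e₃ Ψ) (bottom h p)))
  have hqνd : ∀ p : ℝ × ℝ, dir e₁ (fun r => trace Φ E r • normalTrace E Ψ r) (t, p)
      = dir e₁ (trace Φ E) (t, p) • normalTrace E Ψ (t, p)
        + trace Φ E (t, p)
          • -(dir e₂ (fun r => dir e₁ E r • dir e₁ (dir e₃ Ψ) (surf E r)) (t, p)
            + dir e₃ (fun r => dir e₁ E r • dir e₂ (dir e₃ Ψ) (surf E r)) (t, p)) := by
    intro p
    rw [dir_smul (hf.dominated_trace.differentiableAt (hmem p))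
      ((hf.dominated_normalTrace hΨ).differentiableAt (hmem p)), hf.dir_normalTrace hΨ (hmem p)]
    abel
  have i1 := hqν.integrable_dir hDG ht e₁
  have i2 : Integrable (fun p : ℝ × ℝ => trace Φ E (t, p)
          • -(dir e₂ (fun r => dir e₁ E r • dir e₁ (dir e₃ Ψ) (surf E r)) (t, p)
            + dir e₃ (fun r => dir e₁ E r • dir e₂ (dir e₃ Ψ) (surf E r)) (t, p))) := by
    obtain ⟨K, hK⟩ := hf.dominated_trace.bound
    obtain ⟨L, hL⟩ := ha.exists_bound_dir e₂
    obtain ⟨M, hM⟩ := hb.exists_bound_dir e₃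
    refine (hDG.const_mul (K * (L + M))).mono'
      ((hf.dominated_trace.aestronglyMeasurable ht).smul
        ((ha.aestronglyMeasurable_dir ht e₂).add (hb.aestronglyMeasurable_dir ht e₃)).neg)
      (.of_forall fun p => ?_)
    have h1 := hK _ (hmem p)
    have h2 := norm_add_le_of_le (hL _ (hmem p)) (hM _ (hmem p))
    rw [norm_smul, norm_neg]
    calc _ ≤ (K * D p) * (L * G p + M * G p) :=
          mul_le_mul h1 h2 (norm_nonneg _) ((norm_nonneg _).trans h1)
      _ = _ := by ring
  have hdens : ∀ p : ℝ × ℝ, secondDensity Φ E Ψ (t, p)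
      = dir e₁ (trace Φ E) (t, p) • normalTrace E Ψ (t, p)
        + (dir e₂ (trace Φ E) (t, p)
            • (dir e₁ E (t, p) • dir e₁ (dir e₃ Ψ) (surf E (t, p)))
          + dir e₃ (trace Φ E) (t, p)
            • (dir e₁ E (t, p) • dir e₂ (dir e₃ Ψ) (surf E (t, p)))) := by
    intro p
    simp only [secondDensity]
    module
  have i3 : Integrable (fun p : ℝ × ℝ =>
      dir e₁ (trace Φ E) (t, p) • normalTrace E Ψ (t, p)) := by
    refine (i1.sub i2).congr (.of_forall fun p => ?_)
    simp only [Pi.sub_apply, hqνd p]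
    abel
  refine ⟨(i3.add hi).congr (.of_forall fun p => (hdens p).symm),
    (hB.integrable_dir hDG ht e₁).congr (.of_forall hBd), ?_⟩
  have hder := (hqν.hasDerivAt_integral hDG hU).sub (hB.hasDerivAt_integral hDG hU)
  rw [integral_congr_ae (.of_forall hBd), integral_congr_ae (.of_forall hqνd),
    integral_add i3 i2, ← hI, ← integral_add i3 hi,
    ← integral_congr_ae (.of_forall hdens)] at hder
  refine hder.congr_of_eventuallyEq ?_
  filter_upwards [hU] with s hs using hf.integral_rate hΨ hDG hs

end Core


/-! ### Partial derivatives of curried fields -/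

section Bridge

variable {F : Type*} [NormedAddCommGroup F] [NormedSpace ℝ F]

/-- A curried field of three variables as a function on `ℝ³`. -/
def unc3 (f : ℝ → ℝ → ℝ → F) (r : ℝ × ℝ × ℝ) : F := f r.1 r.2.1 r.2.2

/-- A curried field of four variables as a function on `ℝ⁴`. -/
def unc4 (f : ℝ → ℝ → ℝ → ℝ → F) (r : ℝ × ℝ × ℝ × ℝ) : F := f r.1 r.2.1 r.2.2.1 r.2.2.2

variable {f : ℝ → ℝ → ℝ → F} {g : ℝ × ℝ × ℝ → F} {x y z : ℝ}

theorem Dx_eq_dir (hg : DifferentiableAt ℝ g (x, y, z)) (h : unc3 f =ᶠ[𝓝 (x, y, z)] g) :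
    Dx f x y z = dir e₁ g (x, y, z) := by
  rw [← dir_congr h]
  exact (hasDerivAt_curve (f := unc3 f) (c := fun s => (s, y, z)) (h.differentiableAt_iff.2 hg)
    (hasDerivAt_fst x (y, z))).deriv

theorem Dy_eq_dir (hg : DifferentiableAt ℝ g (x, y, z)) (h : unc3 f =ᶠ[𝓝 (x, y, z)] g) :
    Dy f x y z = dir e₂ g (x, y, z) := by
  rw [← dir_congr h]
  exact (hasDerivAt_curve (f := unc3 f) (c := fun s => (x, s, z)) (h.differentiableAt_iff.2 hg)
    (hasDerivAt_snd x y z)).deriv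

theorem Dz_eq_dir (hg : DifferentiableAt ℝ g (x, y, z)) (h : unc3 f =ᶠ[𝓝 (x, y, z)] g) :
    Dz f x y z = dir e₃ g (x, y, z) := by
  rw [← dir_congr h]
  exact (hasDerivAt_curve (f := unc3 f) (c := fun s => (x, y, s)) (h.differentiableAt_iff.2 hg)
    (hasDerivAt_thd x y z)).deriv

theorem unc3_Dx_eventuallyEq {r : ℝ × ℝ × ℝ} (hf : ContDiffAt ℝ 1 (unc3 f) r) :
    unc3 (Dx f) =ᶠ[𝓝 r] dir e₁ (unc3 f) := by
  filter_upwards [hf.eventually (by norm_num)] with r' hr'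
  exact Dx_eq_dir (hr'.differentiableAt (by norm_num)) .rfl

theorem unc3_Dy_eventuallyEq {r : ℝ × ℝ × ℝ} (hf : ContDiffAt ℝ 1 (unc3 f) r) :
    unc3 (Dy f) =ᶠ[𝓝 r] dir e₂ (unc3 f) := by
  filter_upwards [hf.eventually (by norm_num)] with r' hr'
  exact Dy_eq_dir (hr'.differentiableAt (by norm_num)) .rfl

theorem unc3_Dz_eventuallyEq {r : ℝ × ℝ × ℝ} (hf : ContDiffAt ℝ 1 (unc3 f) r) :
    unc3 (Dz f) =ᶠ[𝓝 r] dir e₃ (unc3 f) := by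
  filter_upwards [hf.eventually (by norm_num)] with r' hr'
  exact Dz_eq_dir (hr'.differentiableAt (by norm_num)) .rfl

theorem differentiableAt_dir {X : Type*} [NormedAddCommGroup X] [NormedSpace ℝ X] {f : X → F}
    {r : X} (hf : ContDiffAt ℝ 2 f r) (v : X) : DifferentiableAt ℝ (dir v f) r :=
  (hf.dir (m := 1) (by norm_num) v).differentiableAt (by norm_num)

theorem lap_eq_laplacian₃ (hf : ContDiffAt ℝ 2 (unc3 f) (x, y, z)) :
    lap f x y z = laplacian₃ (unc3 f) (x, y, z) := by
  have h1 := hf.of_le (m := 1) (by norm_num)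
  rw [lap, laplacian₃, Dx_eq_dir (differentiableAt_dir hf e₁) (unc3_Dx_eventuallyEq h1),
    Dy_eq_dir (differentiableAt_dir hf e₂) (unc3_Dy_eventuallyEq h1),
    Dz_eq_dir (differentiableAt_dir hf e₃) (unc3_Dz_eventuallyEq h1)]

theorem Dt_eq_dir {f : ℝ → ℝ → ℝ → ℝ → F} {t : ℝ}
    (hf : DifferentiableAt ℝ (unc4 f) (t, x, y, z)) :
    Dt f t x y z = dir (1, 0) (unc4 f) (t, x, y, z) :=
  (hasDerivAt_curve (f := unc4 f) (c := fun s => (s, x, y, z)) hf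
    ((hasDerivAt_id t).prodMk (hasDerivAt_const t _))).deriv

theorem contDiffAt_slice {f : ℝ → ℝ → ℝ → ℝ → F} {t : ℝ} {r : ℝ × ℝ × ℝ} {n : WithTop ℕ∞}
    (hf : ContDiffAt ℝ n (unc4 f) (t, r)) : ContDiffAt ℝ n (unc3 (f t)) r :=
  hf.comp (f := fun r => (t, r)) r (contDiffAt_const.prodMk contDiffAt_id)

theorem differentiableAt_slice {f : ℝ → ℝ → ℝ → ℝ → F} {t : ℝ} {r : ℝ × ℝ × ℝ}
    (hf : DifferentiableAt ℝ (unc4 f) (t, r)) : DifferentiableAt ℝ (unc3 (f t)) r :=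
  hf.comp (f := fun r => (t, r)) r (by fun_prop)

theorem Dx_slice {f : ℝ → ℝ → ℝ → ℝ → F} {t : ℝ}
    (hf : DifferentiableAt ℝ (unc4 f) (t, x, y, z)) :
    Dx (f t) x y z = dir (0, e₁) (unc4 f) (t, x, y, z) :=
  (Dx_eq_dir (differentiableAt_slice hf) .rfl).trans (dir_slice hf e₁)

theorem Dy_slice {f : ℝ → ℝ → ℝ → ℝ → F} {t : ℝ}
    (hf : DifferentiableAt ℝ (unc4 f) (t, x, y, z)) :
    Dy (f t) x y z = dir (0, e₂) (unc4 f) (t, x, y, z) :=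
  (Dy_eq_dir (differentiableAt_slice hf) .rfl).trans (dir_slice hf e₂)

theorem Dz_slice {f : ℝ → ℝ → ℝ → ℝ → F} {t : ℝ}
    (hf : DifferentiableAt ℝ (unc4 f) (t, x, y, z)) :
    Dz (f t) x y z = dir (0, e₃) (unc4 f) (t, x, y, z) :=
  (Dz_eq_dir (differentiableAt_slice hf) .rfl).trans (dir_slice hf e₃)

theorem sDt_eq_dir {t : ℝ} (hf : DifferentiableAt ℝ (unc3 f) (t, x, y)) :
    sDt f t x y = dir e₁ (unc3 f) (t, x, y) := Dx_eq_dir hf .rfl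

theorem sDx_eq_dir {t : ℝ} (hf : DifferentiableAt ℝ (unc3 f) (t, x, y)) :
    sDx (f t) x y = dir e₂ (unc3 f) (t, x, y) := Dy_eq_dir hf .rfl

theorem sDy_eq_dir {t : ℝ} (hf : DifferentiableAt ℝ (unc3 f) (t, x, y)) :
    sDy (f t) x y = dir e₃ (unc3 f) (t, x, y) := Dz_eq_dir hf .rfl

end Bridge

/-! ### Solutions and test functions on a short time interval -/

section Local

variable {g h ρ : ℝ} {T U : Set ℝ} {φ p : ℝ → ℝ → ℝ → ℝ → ℝ} {η : ℝ → ℝ → ℝ → ℝ}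
  {D G : ℝ × ℝ → ℝ} {ψ : ℝ → ℝ → ℝ → ℂ}

theorem IsSolution.differentiableAt_surface (hsol : IsSolution g h ρ T φ p η) {t : ℝ} (ht : t ∈ T)
    (x y : ℝ) : DifferentiableAt ℝ (unc3 η) (t, x, y) :=
  (hsol.contDiff_surface t ht x y).differentiableAt (by norm_num)

theorem IsSolution.differentiableAt_potential (hsol : IsSolution g h ρ T φ p η) {t : ℝ}
    (ht : t ∈ T) {x y z : ℝ} (h1 : -h ≤ z) (h2 : z ≤ η t x y) :
    DifferentiableAt ℝ (unc4 φ) (t, x, y, z) :=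
  (hsol.contDiff_potential t ht x y z h1 h2).differentiableAt (by norm_num)

theorem IsSolution.flow (hsol : IsSolution g h ρ T φ p η) (hD : IsDecayRate D) (hU : IsOpen U)
    (hUT : U ⊆ T)
    (hη : ∃ C : ℝ, ∀ t ∈ U, ∀ x y, ∀ k ≤ 2,
      ‖iteratedFDeriv ℝ k (unc3 η) (t, x, y)‖ ≤ C * D (x, y))
    (hφ : ∃ C : ℝ, ∀ t ∈ U, ∀ x y z, -h ≤ z → z ≤ η t x y → ∀ k ≤ 2,
      ‖iteratedFDeriv ℝ k (unc4 φ) (t, x, y, z)‖ ≤ C * D (x, y)) :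
    Flow D h U (unc4 φ) (unc3 η) := by
  have hE : ∀ r ∈ U ×ˢ (Set.univ : Set (ℝ × ℝ)), ContDiffAt ℝ 2 (unc3 η) r := fun r hr =>
    hsol.contDiff_surface r.1 (hUT hr.1) r.2.1 r.2.2
  have hΦ : ∀ r ∈ fluid h U (unc3 η), ContDiffAt ℝ 2 (unc4 φ) r := fun r hr =>
    hsol.contDiff_potential r.1 (hUT hr.1) r.2.1 r.2.2.1 r.2.2.2 hr.2.1 hr.2.2
  have hEb : ∀ k ≤ 2, ∃ K : ℝ, ∀ r ∈ U ×ˢ (Set.univ : Set (ℝ × ℝ)),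
      ‖iteratedFDeriv ℝ k (unc3 η) r‖ ≤ K * D r.2 := fun k hk =>
    hη.imp fun C hC r hr => hC r.1 hr.1 r.2.1 r.2.2 k hk
  have hΦb : ∀ k ≤ 2, ∃ K : ℝ, ∀ r ∈ fluid h U (unc3 η),
      ‖iteratedFDeriv ℝ k (unc4 φ) r‖ ≤ K * D (r.2.1, r.2.2.1) := fun k hk =>
    hφ.imp fun C hC r hr => hC r.1 hr.1 r.2.1 r.2.2.1 r.2.2.2 hr.2.1 hr.2.2 k hk
  have hdepth : ∀ t ∈ U, ∀ x y, -h < η t x y := fun t ht => hsol.depth t (hUT ht)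
  refine ⟨hU, hD.nonneg, hD.bounded, fun r hr => hdepth _ hr.1 _ _, hE,
    .of_iteratedFDeriv (fun r hr => (hE r hr).of_le (by norm_num)) fun k hk => hEb k (by omega),
    .dir_of_iteratedFDeriv hE fun k _ hk => hEb k hk,
    .of_iteratedFDeriv (fun r hr => (hΦ r hr).of_le (by norm_num)) fun k hk => hΦb k (by omega),
    hΦ, .dir_of_iteratedFDeriv hΦ fun k _ hk => hΦb k hk, fun t ht => ?_, fun t ht q => ?_, ?_⟩
  · have hsl : ∀ r ∈ layer h (fun p => unc3 η (t, p)), ContDiffAt ℝ 2 (unc3 (φ t)) r := fun r hr =>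
      contDiffAt_slice (hΦ (t, r) ⟨ht, hr⟩)
    refine eq_zero_of_eq_zero_inside (fun q => hdepth t ht q.1 q.2)
      (fun r hr => continuousAt_laplacian₃ (hsl r hr)) fun r h1 h2 => ?_
    exact (lap_eq_laplacian₃ (hsl r ⟨h1.le, h2.le⟩)).symm.trans
      (hsol.laplace t (hUT ht) r.1 r.2.1 r.2.2 h1 h2)
  · exact (Dz_slice (hsol.differentiableAt_potential (hUT ht) le_rfl
      (hdepth t ht q.1 q.2).le)).symm.trans (hsol.bed t (hUT ht) q.1 q.2)
  · rintro ⟨t, x, y⟩ ⟨ht, -⟩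
    have hEd := hsol.differentiableAt_surface (hUT ht) x y
    have hΦd := hsol.differentiableAt_potential (hUT ht) (hdepth t ht x y).le le_rfl
    have hk := hsol.kinematic t (hUT ht) x y
    rw [sDt_eq_dir hEd, sDx_eq_dir hEd, sDy_eq_dir hEd, Dx_slice hΦd, Dy_slice hΦd,
      Dz_slice hΦd] at hk
    change dir e₁ (unc3 η) (t, x, y) = dir (0, e₃) (unc4 φ) (t, x, y, η t x y)
      - dir e₂ (unc3 η) (t, x, y) * dir (0, e₁) (unc4 φ) (t, x, y, η t x y)
      - dir e₃ (unc3 η) (t, x, y) * dir (0, e₂) (unc4 φ) (t, x, y, η t x y)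
    linarith

theorem IsTestFunction.test (hψ : IsTestFunction G h T η ψ) (hsol : IsSolution g h ρ T φ p η)
    (hUT : U ⊆ T)
    (hb : ∃ C : ℝ, ∀ t ∈ U, ∀ x y z, -h ≤ z → z ≤ η t x y → ∀ k, 1 ≤ k → k ≤ 3 →
      ‖iteratedFDeriv ℝ k (unc3 ψ) (x, y, z)‖ ≤ C * G (x, y)) :
    Test (fun q => |G q|) h U (unc3 η) (unc3 ψ) := by
  have hΨ : ∀ r ∈ swept h U (unc3 η), ContDiffAt ℝ 3 (unc3 ψ) r := by
    rintro r ⟨t, ht, hr⟩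
    exact hψ.contDiff t (hUT ht) r.1 r.2.1 r.2.2 hr.1 hr.2
  have hΨb : ∀ k, 1 ≤ k → k ≤ 3 → ∃ K : ℝ, ∀ r ∈ swept h U (unc3 η),
      ‖iteratedFDeriv ℝ k (unc3 ψ) r‖ ≤ K * |G (r.1, r.2.1)| := by
    intro k h1 h3
    obtain ⟨C, hC⟩ := hb
    refine ⟨|C|, ?_⟩
    rintro r ⟨t, ht, hr⟩
    refine (hC t ht r.1 r.2.1 r.2.2 hr.1 hr.2 k h1 h3).trans ?_
    rw [← abs_mul]
    exact le_abs_self _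
  have hinside : ∀ t ∈ U, ∀ r : ℝ × ℝ × ℝ, -h < r.2.2 → r.2.2 < unc3 η (t, r.1, r.2.1) →
      laplacian₃ (unc3 ψ) r = 0 := by
    intro t ht r h1 h2
    exact (lap_eq_laplacian₃ ((hΨ r ⟨t, ht, h1.le, h2.le⟩).of_le (by norm_num))).symm.trans
      (hψ.harmonic t (hUT ht) r.1 r.2.1 r.2.2 h1 h2)
  refine ⟨hΨ, fun v => .dir_of_iteratedFDeriv (fun r hr => (hΨ r hr).of_le (by norm_num))
    (fun k h1 h2 => hΨb k h1 (by omega)) v, fun v w => ?_, ?_, ?_⟩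
  · refine .dir_of_iteratedFDeriv (fun r hr => (hΨ r hr).dir (by norm_num) w)
      (fun k h1 h2 => exists_bound_iteratedFDeriv_dir hΨ ?_ (hΨb (k + 1) (by omega) (by omega)) w) v
    interval_cases k <;> norm_num
  · rintro r ⟨t, ht, hr⟩
    exact eq_zero_of_eq_zero_inside (ζ := fun q => unc3 η (t, q))
      (fun q => hsol.depth t (hUT ht) q.1 q.2)
      (fun r hr => continuousAt_laplacian₃ ((hΨ r ⟨t, ht, hr⟩).of_le (by norm_num)))
      (hinside t ht) r hr
  · rintro r ⟨t, ht, hr⟩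
    refine eq_zero_of_eq_zero_inside (ζ := fun q => unc3 η (t, q))
      (fun q => hsol.depth t (hUT ht) q.1 q.2)
      (fun r hr => continuousAt_laplacian₃ ((hΨ r ⟨t, ht, hr⟩).dir (by norm_num) e₃))
      (fun r h1 h2 => ?_) r hr
    -- inside the layer `ψ` is harmonic in a neighbourhood, by continuity of the elevation
    refine laplacian₃_dir_eq_zero (hΨ r ⟨t, ht, h1.le, h2.le⟩) ?_ e₃
    have hη : ContinuousAt (fun r : ℝ × ℝ × ℝ => unc3 η (t, r.1, r.2.1)) r :=
      (hsol.differentiableAt_surface (hUT ht) r.1 r.2.1).continuousAt.comp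
        (f := fun r : ℝ × ℝ × ℝ => (t, r.1, r.2.1)) (by fun_prop)
    have hz : ContinuousAt (fun r : ℝ × ℝ × ℝ => r.2.2) r := by fun_prop
    filter_upwards [hz.eventually (lt_mem_nhds h1), hz.eventually_lt hη h2] with r' h1' h2'
    exact hinside t ht r' h1' h2'

/-- Near every time there are bounds that are uniform in time. -/
theorem exists_flow_test (hT : IsOpen T) (hsol : IsSolution g h ρ T φ p η) (hD : IsDecayRate D)
    (hdecay : DecaysAtRate D h T φ η) (hψ : IsTestFunction G h T η ψ) {t : ℝ} (ht : t ∈ T) :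
    ∃ U, t ∈ U ∧ U ⊆ T ∧ Flow D h U (unc4 φ) (unc3 η) ∧
      Test (fun q => |G q|) h U (unc3 η) (unc3 ψ) := by
  obtain ⟨C₁, h₁⟩ := hdecay.surface t ht
  obtain ⟨C₂, h₂⟩ := hdecay.potential t ht
  obtain ⟨C₃, h₃⟩ := hψ.growth t ht
  obtain ⟨U, hU, hUo, htU⟩ := eventually_nhds_iff.1 ((hT.eventually_mem ht).and (h₁.and (h₂.and h₃)))
  exact ⟨U, htU, fun s hs => (hU s hs).1,
    hsol.flow hD hUo (fun s hs => (hU s hs).1) ⟨C₁, fun s hs => (hU s hs).2.1⟩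
      ⟨C₂, fun s hs => (hU s hs).2.2.1⟩,
    hψ.test hsol (fun s hs => (hU s hs).1) ⟨C₃, fun s hs => (hU s hs).2.2.2⟩⟩

end Local


/-! ### The local equation -/

section Equations

variable {g h ρ : ℝ} {T U : Set ℝ} {φ p : ℝ → ℝ → ℝ → ℝ → ℝ} {η : ℝ → ℝ → ℝ → ℝ}
  {D G : ℝ × ℝ → ℝ} {ψ : ℝ → ℝ → ℝ → ℂ}

theorem unc3_surfPot : unc3 (surfPot φ η) = trace (unc4 φ) (unc3 η) := rfl

theorem differentiableAt_trace {Φ : ℝ × ℝ × ℝ × ℝ → ℝ} {E : ℝ × ℝ × ℝ → ℝ} {r : ℝ × ℝ × ℝ}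
    (hE : DifferentiableAt ℝ E r) (hΦ : DifferentiableAt ℝ Φ (r.1, surf E r)) :
    DifferentiableAt ℝ (trace Φ E) r :=
  hΦ.comp (f := fun r => (r.1, surf E r)) r (differentiableAt_fst.prodMk (differentiableAt_surf hE))

theorem IsSolution.localEq (hsol : IsSolution g h ρ T φ p η) {t : ℝ} (ht : t ∈ T) (x y : ℝ) :
    sDt (surfPot φ η) t x y = localRhs g (surfPot φ η) η t x y := by
  have hE := hsol.differentiableAt_surface ht x y
  have hΦ := hsol.differentiableAt_potential ht (hsol.depth t ht x y).le le_rfl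
  have hq : DifferentiableAt ℝ (unc3 (surfPot φ η)) (t, x, y) := differentiableAt_trace hE hΦ
  have hk := hsol.kinematic t ht x y
  have hd := hsol.dynamic t ht x y
  have hdir := fun v => dir_potential_trace (r := (t, x, y)) hE hΦ v
  simp only [show surf (unc3 η) (t, x, y) = (x, y, η t x y) from rfl] at hdir
  have hpos : (1 : ℝ) + (sDx (η t) x y ^ 2 + sDy (η t) x y ^ 2) ≠ 0 := by positivity
  have h1 : sDt (surfPot φ η) t x y
      = Dt φ t x y (η t x y) + sDt η t x y * Dz (φ t) x y (η t x y) := by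
    rw [sDt_eq_dir hq, unc3_surfPot, hdir, Dt_eq_dir hΦ, Dz_slice hΦ, sDt_eq_dir hE]
    simp [e₁]
  have h2 : sDx (surfPot φ η t) x y
      = Dx (φ t) x y (η t x y) + sDx (η t) x y * Dz (φ t) x y (η t x y) := by
    rw [sDx_eq_dir hq, unc3_surfPot, hdir, Dx_slice hΦ, Dz_slice hΦ, sDx_eq_dir hE]
    simp [e₂]
  have h3 : sDy (surfPot φ η t) x y
      = Dy (φ t) x y (η t x y) + sDy (η t) x y * Dz (φ t) x y (η t x y) := by
    rw [sDy_eq_dir hq, unc3_surfPot, hdir, Dy_slice hΦ, Dz_slice hΦ, sDy_eq_dir hE]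
    simp [e₃]
  -- the numerator of the last term is `φ_z (1 + |∇η|²)`
  have h4 : sDt η t x y + (sDx (surfPot φ η t) x y * sDx (η t) x y
      + sDy (surfPot φ η t) x y * sDy (η t) x y)
      = Dz (φ t) x y (η t x y) * (1 + (sDx (η t) x y ^ 2 + sDy (η t) x y ^ 2)) := by
    rw [h2, h3]
    linear_combination hk
  have h5 : ∀ a b : ℝ, b ≠ 0 → (a * b) ^ 2 / b = a ^ 2 * b := by
    intro a b hb
    field_simp
  rw [localRhs, h4, h5 _ _ hpos, h1, h2, h3]
  rw [gradSq] at hd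
  linear_combination hd + Dz (φ t) x y (η t x y) * hk

/-! ### The integral equations -/

theorem fluxDensity_eq (ζ : ℝ → ℝ → ℝ) (F : ℝ → ℝ → Fin 3 → ℂ) (x y : ℝ) :
    fluxDensity ζ F x y = F x y 2 - sDx ζ x y • F x y 0 - sDy ζ x y • F x y 1 := by
  have ha : (areaElement ζ x y : ℂ) ≠ 0 := by
    rw [Complex.ofReal_ne_zero, areaElement]
    positivity
  simp only [fluxDensity, unitNormal, Fin.sum_univ_three, Complex.real_smul]
  simp
  field_simp
  ring

theorem Flow.surf_mem_swept' (hf : Flow D h U (unc4 φ) (unc3 η)) {t : ℝ} (ht : t ∈ U) (x y : ℝ) :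
    ((x, y, η t x y) : ℝ × ℝ × ℝ) ∈ swept h U (unc3 η) :=
  hf.surf_mem_swept (r := (t, x, y)) ⟨ht, trivial⟩

theorem Flow.bottom_mem_swept (hf : Flow D h U (unc4 φ) (unc3 η)) {t : ℝ} (ht : t ∈ U) (x y : ℝ) :
    ((x, y, -h) : ℝ × ℝ × ℝ) ∈ swept h U (unc3 η) :=
  ⟨t, ht, hf.bottom_mem_layer ht (x, y)⟩

theorem Flow.sD_elevation (hf : Flow D h U (unc4 φ) (unc3 η)) {t : ℝ} (ht : t ∈ U) (x y : ℝ) :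
    sDt η t x y = dir e₁ (unc3 η) (t, x, y) ∧ sDx (η t) x y = dir e₂ (unc3 η) (t, x, y) ∧
      sDy (η t) x y = dir e₃ (unc3 η) (t, x, y) := by
  have hE := hf.elevation.differentiableAt (r := (t, x, y)) ⟨ht, trivial⟩
  exact ⟨sDt_eq_dir hE, sDx_eq_dir hE, sDy_eq_dir hE⟩

theorem Flow.sD_surfPot (hf : Flow D h U (unc4 φ) (unc3 η)) {t : ℝ} (ht : t ∈ U) (x y : ℝ) :
    sDt (surfPot φ η) t x y = dir e₁ (trace (unc4 φ) (unc3 η)) (t, x, y) ∧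
      sDx (surfPot φ η t) x y = dir e₂ (trace (unc4 φ) (unc3 η)) (t, x, y) ∧
      sDy (surfPot φ η t) x y = dir e₃ (trace (unc4 φ) (unc3 η)) (t, x, y) := by
  have hq := hf.dominated_trace.differentiableAt (r := (t, x, y)) ⟨ht, trivial⟩
  exact ⟨sDt_eq_dir hq, sDx_eq_dir hq, sDy_eq_dir hq⟩

theorem Test.D_eq {E : ℝ × ℝ × ℝ → ℝ} (hψ : Test G h U E (unc3 ψ)) {x y z : ℝ}
    (hr : (x, y, z) ∈ swept h U E) :
    Dx ψ x y z = dir e₁ (unc3 ψ) (x, y, z) ∧ Dy ψ x y z = dir e₂ (unc3 ψ) (x, y, z) ∧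
      Dz ψ x y z = dir e₃ (unc3 ψ) (x, y, z) := by
  have hd := (hψ.contDiffAt _ hr).differentiableAt (by norm_num)
  exact ⟨Dx_eq_dir hd .rfl, Dy_eq_dir hd .rfl, Dz_eq_dir hd .rfl⟩

theorem Test.D_Dz_eq {E : ℝ × ℝ × ℝ → ℝ} (hψ : Test G h U E (unc3 ψ)) {x y z : ℝ}
    (hr : (x, y, z) ∈ swept h U E) :
    Dx (Dz ψ) x y z = dir e₁ (dir e₃ (unc3 ψ)) (x, y, z) ∧
      Dy (Dz ψ) x y z = dir e₂ (dir e₃ (unc3 ψ)) (x, y, z) ∧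
      Dz (Dz ψ) x y z = dir e₃ (dir e₃ (unc3 ψ)) (x, y, z) := by
  have hd := (hψ.dominated_dir e₃).differentiableAt hr
  have he := unc3_Dz_eventuallyEq ((hψ.contDiffAt _ hr).of_le (m := 1) (by norm_num))
  exact ⟨Dx_eq_dir hd he, Dy_eq_dir hd he, Dz_eq_dir hd he⟩

theorem Flow.hasDerivAt_comp_elevation (hf : Flow D h U (unc4 φ) (unc3 η))
    (hψ : Test G h U (unc3 η) (unc3 ψ)) {t : ℝ} (ht : t ∈ U) (q : ℝ × ℝ) :
    HasDerivAt (fun s => ψ q.1 q.2 (η s q.1 q.2))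
      (dir e₁ (unc3 η) (t, q) • dir e₃ (unc3 ψ) (surf (unc3 η) (t, q))) t := by
  have hr : (t, q) ∈ U ×ˢ (Set.univ : Set (ℝ × ℝ)) := ⟨ht, trivial⟩
  have hE := hf.elevation.differentiableAt hr
  have hΨ := (hψ.contDiffAt _ (hf.surf_mem_swept hr)).differentiableAt (by norm_num)
  have h1 : DifferentiableAt ℝ (fun r => unc3 ψ (surf (unc3 η) r)) (t, q) :=
    hΨ.comp (t, q) (differentiableAt_surf hE)
  have h2 := hasDerivAt_curve (c := fun s => (s, q)) h1 (hasDerivAt_fst t q)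
  rw [dir_trace hE hΨ] at h2
  simp only [zero_smul, zero_add] at h2
  exact h2

theorem Flow.firstEq (hf : Flow D h U (unc4 φ) (unc3 η)) (hψ : Test G h U (unc3 η) (unc3 ψ))
    (hDG : Integrable fun q => D q * G q) {t : ℝ} (ht : t ∈ U) : FirstEq h φ η ψ t := by
  have e1 : (fun q : ℝ × ℝ => deriv (fun s => ψ q.1 q.2 (η s q.1 q.2)) t)
      = fun q => dir e₁ (unc3 η) (t, q) • dir e₃ (unc3 ψ) (surf (unc3 η) (t, q)) := by
    funext q
    exact (hf.hasDerivAt_comp_elevation hψ ht q).deriv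
  have e2 : (fun q : ℝ × ℝ => tangentialTerm (surfPot φ η t) (η t) ψ q.1 q.2)
      = fun q => dir e₂ (trace (unc4 φ) (unc3 η)) (t, q) • dir e₁ (unc3 ψ) (surf (unc3 η) (t, q))
        + dir e₃ (trace (unc4 φ) (unc3 η)) (t, q) • dir e₂ (unc3 ψ) (surf (unc3 η) (t, q)) := by
    funext q
    obtain ⟨-, h2, h3⟩ := hf.sD_surfPot ht q.1 q.2
    obtain ⟨h4, h5, -⟩ := hψ.D_eq (hf.surf_mem_swept' ht q.1 q.2)
    rw [tangentialTerm, h2, h3, h4, h5, ← Complex.real_smul, ← Complex.real_smul]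
    rfl
  have e3 : (fun q : ℝ × ℝ => (φ t q.1 q.2 (-h) : ℂ) * Dz (Dz ψ) q.1 q.2 (-h))
      = fun q => unc4 φ (t, bottom h q) • dir e₃ (dir e₃ (unc3 ψ)) (bottom h q) := by
    funext q
    rw [(hψ.D_Dz_eq (hf.bottom_mem_swept ht q.1 q.2)).2.2, Complex.real_smul]
    rfl
  rw [FirstEq, e1, e2, e3]
  exact ⟨(hf.dominated_rate hψ).integrable hDG ht,
    (hf.integral_trace_mul hDG (hf.dominated_comp_surf (hψ.dominated_dir e₁))
      (hf.dominated_comp_surf (hψ.dominated_dir e₂)) ht).1,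
    (hf.dominated_bottom hψ).integrable hDG ht, hf.first hψ hDG ht⟩

theorem Flow.hasDerivAt_integral_comp_elevation (hf : Flow D h U (unc4 φ) (unc3 η))
    (hψ : Test G h U (unc3 η) (unc3 ψ)) (hDG : Integrable fun q => D q * G q) {t : ℝ}
    (ht : t ∈ U) (hi : Integrable fun q : ℝ × ℝ => ψ q.1 q.2 (η t q.1 q.2)) :
    HasDerivAt (fun s => ∫ q : ℝ × ℝ, ψ q.1 q.2 (η s q.1 q.2))
      (∫ q : ℝ × ℝ, deriv (fun s => ψ q.1 q.2 (η s q.1 q.2)) t) t := by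
  have hrate := hf.dominated_rate hψ
  obtain ⟨K, hK⟩ := hrate.bound
  have hU := hf.isOpen.mem_nhds ht
  have hmeas : AEStronglyMeasurable (fun q : ℝ × ℝ =>
      dir e₁ (unc3 η) (t, q) • dir e₃ (unc3 ψ) (surf (unc3 η) (t, q))) :=
    (hrate.integrable hDG ht).aestronglyMeasurable
  rw [integral_congr_ae (.of_forall fun q => (hf.hasDerivAt_comp_elevation hψ ht q).deriv)]
  refine (hasDerivAt_integral_of_dominated_loc_of_deriv_le
    (bound := fun q => K * (D q * G q)) hU (Filter.eventually_of_mem hU fun s hs => ?_) hi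
    (F' := fun s q => dir e₁ (unc3 η) (s, q) • dir e₃ (unc3 ψ) (surf (unc3 η) (s, q)))
    hmeas (.of_forall fun q s hs => hK (s, q) ⟨hs, trivial⟩)
    (hDG.const_mul K) (.of_forall fun q s hs => hf.hasDerivAt_comp_elevation hψ hs q)).2
  refine Continuous.aestronglyMeasurable (continuous_iff_continuousAt.2 fun q => ?_)
  have hr : (s, q) ∈ U ×ˢ (Set.univ : Set (ℝ × ℝ)) := ⟨hs, trivial⟩
  have h1 : ContinuousAt (fun r => unc3 ψ (surf (unc3 η) r)) (s, q) :=
    (hψ.contDiffAt _ (hf.surf_mem_swept hr)).continuousAt.comp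
      (differentiableAt_surf (hf.elevation.differentiableAt hr)).continuousAt
  exact h1.comp (f := fun q : ℝ × ℝ => (s, q)) (by fun_prop)

theorem Flow.fluxDensity_secondField (hf : Flow D h U (unc4 φ) (unc3 η))
    (hψ : Test G h U (unc3 η) (unc3 ψ)) {a : ℝ → ℝ → ℝ → ℝ} {t : ℝ} (ht : t ∈ U)
    (ha : ∀ x y, a t x y = sDt (surfPot φ η) t x y) (q : ℝ × ℝ) :
    fluxDensity (η t) (secondField (a t) (surfPot φ η t) (η t) (φ t) ψ) q.1 q.2
      = secondDensity (unc4 φ) (unc3 η) (unc3 ψ) (t, q) := by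
  have hr : (t, q) ∈ U ×ˢ (Set.univ : Set (ℝ × ℝ)) := ⟨ht, trivial⟩
  obtain ⟨-, a2, a3⟩ := hf.sD_elevation ht q.1 q.2
  obtain ⟨b1, b2, b3⟩ := hf.sD_surfPot ht q.1 q.2
  obtain ⟨c1, c2, c3⟩ := hψ.D_Dz_eq (hf.surf_mem_swept' ht q.1 q.2)
  have hΦ : DifferentiableAt ℝ (unc4 φ) (t, q.1, q.2, η t q.1 q.2) :=
    hf.potential.differentiableAt (hf.surf_mem_fluid hr)
  have hk : dir e₁ (unc3 η) (t, q.1, q.2)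
      = dir (0, e₃) (unc4 φ) (t, q.1, q.2, η t q.1 q.2)
      - dir e₂ (unc3 η) (t, q.1, q.2) * dir (0, e₁) (unc4 φ) (t, q.1, q.2, η t q.1 q.2)
      - dir e₃ (unc3 η) (t, q.1, q.2) * dir (0, e₂) (unc4 φ) (t, q.1, q.2, η t q.1 q.2) :=
    hf.kinematic _ hr
  have hsecond : secondDensity (unc4 φ) (unc3 η) (unc3 ψ) (t, q)
      = secondDensity (unc4 φ) (unc3 η) (unc3 ψ) (t, q.1, q.2) := rfl
  rw [fluxDensity_eq, hsecond, secondDensity, normalTrace, hk]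
  simp only [secondField, grad, tangentialTerm, ha, a2, a3, b1, b2, b3, c1, c2, c3, Dx_slice hΦ,
    Dy_slice hΦ, Dz_slice hΦ, Complex.real_smul, Matrix.cons_val,
    show surf (unc3 η) (t, q.1, q.2) = (q.1, q.2, η t q.1 q.2) from rfl]
  push_cast
  ring

theorem Flow.secondEq (hf : Flow D h U (unc4 φ) (unc3 η)) (hψ : Test G h U (unc3 η) (unc3 ψ))
    (hDG : Integrable fun q => D q * G q) {a : ℝ → ℝ → ℝ → ℝ} {t : ℝ} (ht : t ∈ U)
    (ha : ∀ x y, a t x y = sDt (surfPot φ η) t x y) : SecondEq h φ η a ψ t := by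
  have hU := hf.isOpen.mem_nhds ht
  have e1 : ∀ s ∈ U, (fun q : ℝ × ℝ => Dz ψ q.1 q.2 (η s q.1 q.2) * ((sDt η s q.1 q.2 : ℝ) : ℂ))
      = fun q => dir e₁ (unc3 η) (s, q) • dir e₃ (unc3 ψ) (surf (unc3 η) (s, q)) := by
    intro s hs
    funext q
    rw [(hψ.D_eq (hf.surf_mem_swept' hs q.1 q.2)).2.2, (hf.sD_elevation hs q.1 q.2).1, mul_comm,
      ← Complex.real_smul]
    rfl
  have e2 : (fun q : ℝ × ℝ => fluxDensity (η t)
      (secondField (a t) (surfPot φ η t) (η t) (φ t) ψ) q.1 q.2)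
      = fun q => secondDensity (unc4 φ) (unc3 η) (unc3 ψ) (t, q) :=
    funext (hf.fluxDensity_secondField hψ ht ha)
  have e3 : (fun q : ℝ × ℝ => ((Dt φ t q.1 q.2 (-h) : ℝ) : ℂ) * Dz (Dz ψ) q.1 q.2 (-h))
      = fun q => dir (1, 0) (unc4 φ) (t, bottom h q)
        • dir e₃ (dir e₃ (unc3 ψ)) (bottom h q) := by
    funext q
    have hΦ : DifferentiableAt ℝ (unc4 φ) (t, q.1, q.2, -h) :=
      hf.potential.differentiableAt ⟨ht, hf.bottom_mem_layer ht q⟩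
    rw [(hψ.D_Dz_eq (hf.bottom_mem_swept ht q.1 q.2)).2.2, Dt_eq_dir hΦ, Complex.real_smul]
    rfl
  obtain ⟨i1, i2, hder⟩ := hf.second hψ hDG ht
  rw [SecondEq, e2, e3]
  refine ⟨?_, i1, i2, _, hder.congr_of_eventuallyEq ?_, by abel⟩
  · filter_upwards [hU] with s hs
    rw [e1 s hs]
    exact (hf.dominated_rate hψ).integrable hDG hs
  · filter_upwards [hU] with s hs
    rw [e1 s hs]

end Equations


/-! ### Special test functions -/

section Special

variable {g h ρ : ℝ} {T : Set ℝ} {φ p : ℝ → ℝ → ℝ → ℝ → ℝ} {η : ℝ → ℝ → ℝ → ℝ}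
  {D : ℝ × ℝ → ℝ} {ψ : ℝ → ℝ → ℝ → ℂ}

/-- A `C³` harmonic function that horizontal translations only multiply by phases is a test
function with bounded growth: its derivatives need to be bounded only above the origin, where `z`
ranges over a bounded interval because the elevation is bounded. -/
theorem isTestFunction_of_phase (hD : IsDecayRate D) (hdecay : DecaysAtRate D h T φ η)
    (hψ : ContDiff ℝ 3 (unc3 ψ)) (hlap : ∀ x y z, lap ψ x y z = 0)
    (hphase : ∀ x y : ℝ, ∃ c : ℂ, ‖c‖ = 1 ∧
      ∀ r : ℝ × ℝ × ℝ, unc3 ψ (r + (x, y, 0)) = c • unc3 ψ r) :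
    IsTestFunction (fun _ => 1) h T η ψ := by
  refine ⟨fun _ _ x y z _ _ => hlap x y z, fun _ _ _ _ _ _ _ => hψ.contDiffAt, fun t ht => ?_⟩
  obtain ⟨C, hC⟩ := hdecay.surface t ht
  obtain ⟨M, hM⟩ := hD.bounded
  have hK : ∀ k : ℕ, ∃ K : ℝ, k ≤ 3 → ∀ z ∈ Set.Icc (-h) (|C| * M),
      ‖iteratedFDeriv ℝ k (unc3 ψ) ((0 : ℝ), (0 : ℝ), z)‖ ≤ K := by
    intro k
    by_cases hk : k ≤ 3
    · have hc : Continuous fun z : ℝ => iteratedFDeriv ℝ k (unc3 ψ) ((0 : ℝ), (0 : ℝ), z) :=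
        (hψ.continuous_iteratedFDeriv (m := k) (by exact_mod_cast hk)).comp (by fun_prop)
      obtain ⟨K, hK⟩ := isCompact_Icc.exists_bound_of_continuousOn hc.continuousOn
      exact ⟨K, fun _ => hK⟩
    · exact ⟨0, fun h => absurd h hk⟩
  choose K hK using hK
  refine ⟨∑ k ∈ Finset.range 4, |K k|, hC.mono fun s hs x y z h1 h2 k _ hk => ?_⟩
  have hz : z ≤ |C| * M := by
    have h0 := hs x y 0 (by norm_num)
    rw [norm_iteratedFDeriv_zero, Real.norm_eq_abs] at h0
    calc z ≤ |η s x y| := h2.trans (le_abs_self _)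
      _ ≤ C * D (x, y) := h0
      _ ≤ |C| * D (x, y) := mul_le_mul_of_nonneg_right (le_abs_self C) (hD.nonneg _)
      _ ≤ |C| * M := mul_le_mul_of_nonneg_left (hM _) (abs_nonneg C)
  obtain ⟨c, hc, hcψ⟩ := hphase x y
  have hshift : iteratedFDeriv ℝ k (unc3 ψ) (x, y, z)
      = c • iteratedFDeriv ℝ k (unc3 ψ) ((0 : ℝ), (0 : ℝ), z) := by
    have h3 := iteratedFDeriv_comp_add_right (𝕜 := ℝ) (f := unc3 ψ) k (x, y, 0)
      ((0 : ℝ), (0 : ℝ), z)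
    rw [funext hcψ] at h3
    have h4 : ((0 : ℝ), (0 : ℝ), z) + (x, y, 0) = (x, y, z) := by simp
    rw [h4] at h3
    rw [← h3]
    exact iteratedFDeriv_const_smul_apply (𝕜 := ℝ) (a := c) (f := unc3 ψ) (hψ.contDiffAt.of_le (by exact_mod_cast hk))
  change ‖iteratedFDeriv ℝ k (unc3 ψ) (x, y, z)‖ ≤ _
  rw [hshift, norm_smul, hc, one_mul, mul_one]
  calc _ ≤ K k := hK k hk z ⟨h1, hz⟩
    _ ≤ |K k| := le_abs_self _
    _ ≤ _ := Finset.single_le_sum (f := fun k => |K k|) (fun i _ => abs_nonneg _)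
        (Finset.mem_range.2 (by omega))

theorem isTestFunction_height (hD : IsDecayRate D) (hdecay : DecaysAtRate D h T φ η) :
    IsTestFunction (fun _ => 1) h T η (fun _ _ z => (z : ℂ)) := by
  refine isTestFunction_of_phase hD hdecay ?_ (fun x y z => ?_) fun x y => ⟨1, by simp, fun r => ?_⟩
  · exact Complex.ofRealCLM.contDiff.comp (contDiff_snd.comp contDiff_snd)
  · have hz : Dz (fun _ _ z => (z : ℂ)) = fun _ _ _ => (1 : ℂ) := by
      funext x y z
      exact (hasDerivAt_id z).ofReal_comp.deriv
    simp only [lap, hz]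
    simp [Dx, Dy, Dz]
  · simp [unc3]

variable (h) (k l : ℝ)

theorem hasDerivAt_phase_x (x y : ℝ) :
    HasDerivAt (fun s : ℝ => Complex.exp (Complex.I * ((k * s + l * y : ℝ) : ℂ)))
      (Complex.I * k * Complex.exp (Complex.I * ((k * x + l * y : ℝ) : ℂ))) x := by
  have h1 : HasDerivAt (fun s : ℝ => k * s + l * y) k x := by
    simpa using ((hasDerivAt_id x).const_mul k).add_const (l * y)
  convert (h1.ofReal_comp.const_mul Complex.I).cexp using 1
  ring

theorem hasDerivAt_phase_y (x y : ℝ) :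
    HasDerivAt (fun s : ℝ => Complex.exp (Complex.I * ((k * x + l * s : ℝ) : ℂ)))
      (Complex.I * l * Complex.exp (Complex.I * ((k * x + l * y : ℝ) : ℂ))) y := by
  have h1 : HasDerivAt (fun s : ℝ => k * x + l * s) l y := by
    simpa using ((hasDerivAt_id y).const_mul l).const_add (k * x)
  convert (h1.ofReal_comp.const_mul Complex.I).cexp using 1
  ring

theorem Dx_afmTest : Dx (afmTest h k l) = fun x y z => Complex.I * k * afmTest h k l x y z := by
  funext x y z
  exact ((hasDerivAt_phase_x k l x y).mul_const _).deriv.trans (mul_assoc _ _ _)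

theorem Dy_afmTest : Dy (afmTest h k l) = fun x y z => Complex.I * l * afmTest h k l x y z := by
  funext x y z
  exact ((hasDerivAt_phase_y k l x y).mul_const _).deriv.trans (mul_assoc _ _ _)

theorem hasDerivAt_afmTest_comp (x y : ℝ) {ζ : ℝ → ℝ} {ζ' s : ℝ} (hζ : HasDerivAt ζ ζ' s) :
    HasDerivAt (fun s => afmTest h k l x y (ζ s))
      (Complex.exp (Complex.I * ((k * x + l * y : ℝ) : ℂ)) *
        ((waveNumber k l * ζ' * Real.cosh (waveNumber k l * (ζ s + h)) : ℝ) : ℂ)) s := by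
  have h1 : HasDerivAt (fun s => Real.sinh (waveNumber k l * (ζ s + h)))
      (waveNumber k l * ζ' * Real.cosh (waveNumber k l * (ζ s + h))) s := by
    convert ((hζ.add_const h).const_mul (waveNumber k l)).sinh using 1
    ring
  exact h1.ofReal_comp.const_mul _

theorem Dz_afmTest (x y z : ℝ) : Dz (afmTest h k l) x y z =
    Complex.exp (Complex.I * ((k * x + l * y : ℝ) : ℂ)) *
      ((waveNumber k l * Real.cosh (waveNumber k l * (z + h)) : ℝ) : ℂ) := by
  have := (hasDerivAt_afmTest_comp h k l x y (hasDerivAt_id z)).deriv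
  simpa [Dz] using this

theorem Dz_Dz_afmTest (x y z : ℝ) : Dz (Dz (afmTest h k l)) x y z
    = (waveNumber k l : ℂ) ^ 2 * afmTest h k l x y z := by
  have h1 : HasDerivAt (fun s => waveNumber k l * Real.cosh (waveNumber k l * (s + h)))
      (waveNumber k l * (Real.sinh (waveNumber k l * (z + h)) * (waveNumber k l * 1))) z :=
    (((hasDerivAt_id z).add_const h).const_mul (waveNumber k l)).cosh.const_mul _
  rw [show Dz (afmTest h k l) = fun x y z => _ from funext fun x => funext fun y => funext fun z =>
    Dz_afmTest h k l x y z, Dz, (h1.ofReal_comp.const_mul _).deriv, afmTest]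
  push_cast
  ring

theorem waveNumber_sq : waveNumber k l ^ 2 = k ^ 2 + l ^ 2 := Real.sq_sqrt (by positivity)

theorem lap_afmTest (x y z : ℝ) : lap (afmTest h k l) x y z = 0 := by
  have h1 : Dx (Dx (afmTest h k l)) x y z = (Complex.I * k) ^ 2 * afmTest h k l x y z := by
    have := congrFun (congrFun (congrFun (Dx_afmTest h k l) x) y) z
    rw [Dx_afmTest, Dx, deriv_const_mul_field, sq, mul_assoc (Complex.I * (k : ℂ)), ← this]
    rfl
  have h2 : Dy (Dy (afmTest h k l)) x y z = (Complex.I * l) ^ 2 * afmTest h k l x y z := by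
    have := congrFun (congrFun (congrFun (Dy_afmTest h k l) x) y) z
    rw [Dy_afmTest, Dy, deriv_const_mul_field, sq, mul_assoc (Complex.I * (l : ℂ)), ← this]
    rfl
  have h3 : (waveNumber k l : ℂ) ^ 2 = (k : ℂ) ^ 2 + (l : ℂ) ^ 2 := by
    exact_mod_cast waveNumber_sq k l
  rw [lap, h1, h2, Dz_Dz_afmTest, h3, mul_pow, mul_pow, Complex.I_sq]
  ring

variable {h}

theorem isTestFunction_afmTest (hD : IsDecayRate D) (hdecay : DecaysAtRate D h T φ η) :
    IsTestFunction (fun _ => 1) h T η (afmTest h k l) := by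
  refine isTestFunction_of_phase hD hdecay ?_ (lap_afmTest h k l) fun x y =>
    ⟨Complex.exp (((k * x + l * y : ℝ) : ℂ) * Complex.I), Complex.norm_exp_ofReal_mul_I _,
      fun r => ?_⟩
  · have h0 : ContDiff ℝ 3 fun r : ℝ × ℝ × ℝ => k * r.1 + l * r.2.1 := by fun_prop
    have h1 : ContDiff ℝ 3 fun r : ℝ × ℝ × ℝ =>
        Complex.exp (Complex.I * ((k * r.1 + l * r.2.1 : ℝ) : ℂ)) :=
      (contDiff_const.mul (Complex.ofRealCLM.contDiff.comp h0)).cexp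
    have h2 : ContDiff ℝ 3 fun r : ℝ × ℝ × ℝ =>
        ((Real.sinh (waveNumber k l * (r.2.2 + h)) : ℝ) : ℂ) :=
      Complex.ofRealCLM.contDiff.comp (ContDiff.sinh (by fun_prop))
    exact h1.mul h2
  · simp only [unc3, afmTest, smul_eq_mul, Prod.fst_add, Prod.snd_add, add_zero]
    rw [← mul_assoc, ← Complex.exp_add]
    congr 2
    push_cast
    ring

theorem afm_identity (hsol : IsSolution g h ρ T φ p η) {t : ℝ} (ht : t ∈ T) (x y : ℝ) :
    deriv (fun s => afmTest h k l x y (η s x y)) t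
        - tangentialTerm (surfPot φ η t) (η t) (afmTest h k l) x y
      = -Complex.I * (waveNumber k l : ℂ) * afmIntegrand h (surfPot φ η) η k l t x y := by
  have hη : HasDerivAt (fun s => η s x y) (sDt η t x y) t := by
    have h1 := hasDerivAt_curve (c := fun s => (s, x, y)) (hsol.differentiableAt_surface ht x y)
      (hasDerivAt_fst t (x, y))
    rw [sDt_eq_dir (hsol.differentiableAt_surface ht x y)]
    exact h1
  have hI : Complex.I ^ 2 = -1 := Complex.I_sq
  rw [(hasDerivAt_afmTest_comp h k l x y hη).deriv, tangentialTerm, Dx_afmTest, Dy_afmTest,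
    afmIntegrand]
  simp only [afmTest]
  rcases eq_or_ne (waveNumber k l) 0 with h0 | h0
  · simp [h0]
  · have h0' : (waveNumber k l : ℂ) ≠ 0 := Complex.ofReal_ne_zero.2 h0
    push_cast
    field_simp
    linear_combination ((waveNumber k l : ℂ) * ((sDt η t x y : ℝ) : ℂ)
      * Complex.cosh ((waveNumber k l : ℂ) * ((η t x y : ℂ) + h))) * hI

/-- The nonlocal equation. For a nonzero wave vector it is the first integral equation for
`afmTest`; for the zero wave vector it is conservation of mass, which is the first integral equation
for the height function. -/
theorem nonlocalEq (hsol : IsSolution g h ρ T φ p η) {t : ℝ} (ht : t ∈ T)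
    (hafm : FirstEq h φ η (afmTest h k l) t) (hheight : FirstEq h φ η (fun _ _ z => (z : ℂ)) t) :
    Integrable (fun r : ℝ × ℝ => afmIntegrand h (surfPot φ η) η k l t r.1 r.2) ∧
      ∫ r : ℝ × ℝ, afmIntegrand h (surfPot φ η) η k l t r.1 r.2 = 0 := by
  rcases eq_or_ne (waveNumber k l) 0 with h0 | h0
  · -- the time derivative of `ψ = z` along the surface is `η_t`
    obtain ⟨i1, -, -, hI⟩ := hheight
    have hsq := waveNumber_sq k l
    have hk : k = 0 := by nlinarith [sq_nonneg k, sq_nonneg l]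
    have hl : l = 0 := by nlinarith [sq_nonneg k, sq_nonneg l]
    have hz : Dz (fun _ _ z => (z : ℂ)) = fun _ _ _ => (1 : ℂ) := by
      funext x y z
      exact (hasDerivAt_id z).ofReal_comp.deriv
    have e1 : (fun r : ℝ × ℝ => afmIntegrand h (surfPot φ η) η k l t r.1 r.2)
        = fun r => Complex.I * deriv (fun s => (η s r.1 r.2 : ℂ)) t := by
      funext r
      have hη := hasDerivAt_curve (c := fun s => (s, r.1, r.2))
        (hsol.differentiableAt_surface ht r.1 r.2) (hasDerivAt_fst t (r.1, r.2))
      have hd : deriv (fun s => (η s r.1 r.2 : ℂ)) t = ((sDt η t r.1 r.2 : ℝ) : ℂ) := by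
        rw [sDt_eq_dir (hsol.differentiableAt_surface ht r.1 r.2)]
        exact hη.ofReal_comp.deriv
      rw [afmIntegrand, hd, h0, hk, hl]
      simp
    rw [e1]
    refine ⟨i1.const_mul _, ?_⟩
    rw [integral_const_mul, hI, hz]
    simp [tangentialTerm, Dx, Dy, Dz]
  · obtain ⟨i1, i2, -, hI⟩ := hafm
    have hc : -Complex.I * (waveNumber k l : ℂ) ≠ 0 :=
      mul_ne_zero (neg_ne_zero.2 Complex.I_ne_zero) (Complex.ofReal_ne_zero.2 h0)
    have e1 : (fun r : ℝ × ℝ => afmIntegrand h (surfPot φ η) η k l t r.1 r.2)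
        = fun r => (-Complex.I * (waveNumber k l : ℂ))⁻¹
          * (deriv (fun s => afmTest h k l r.1 r.2 (η s r.1 r.2)) t
            - tangentialTerm (surfPot φ η t) (η t) (afmTest h k l) r.1 r.2) := by
      funext r
      rw [afm_identity k l hsol ht, inv_mul_cancel_left₀ hc]
    rw [e1]
    refine ⟨(i1.sub i2).const_mul _, ?_⟩
    have hb : ∀ x y, Dz (Dz (afmTest h k l)) x y (-h) = 0 := fun x y => by
      rw [Dz_Dz_afmTest, afmTest]
      simp
    rw [integral_const_mul, integral_sub i1 i2, hI]
    simp [hb]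

end Special

end WaterWave

theorem mainTheorem1 (g h ρ : ℝ) (hρ : 0 < ρ) (T : Set ℝ) (hT : IsOpen T)
    (φ p : ℝ → ℝ → ℝ → ℝ → ℝ) (η : ℝ → ℝ → ℝ → ℝ)
    (hsol : WaterWave.IsSolution g h ρ T φ p η)
    (D : ℝ × ℝ → ℝ) (hD : WaterWave.IsDecayRate D) (hdecay : WaterWave.DecaysAtRate D h T φ η) :
    -- the two integral equations, for every admissible harmonic test function
    (∀ (G : ℝ × ℝ → ℝ), Integrable (fun r => D r * G r) →
      ∀ ψ : ℝ → ℝ → ℝ → ℂ, WaterWave.IsTestFunction G h T η ψ → ∀ t ∈ T,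
        WaterWave.FirstEq h φ η ψ t ∧
        (Integrable (fun r : ℝ × ℝ => ψ r.1 r.2 (η t r.1 r.2)) →
          HasDerivAt (fun s => ∫ r : ℝ × ℝ, ψ r.1 r.2 (η s r.1 r.2))
            ((∫ r : ℝ × ℝ,
                WaterWave.tangentialTerm (WaterWave.surfPot φ η t) (η t) ψ r.1 r.2)
              - ∫ r : ℝ × ℝ, (φ t r.1 r.2 (-h) : ℂ)
                  * WaterWave.Dz (WaterWave.Dz ψ) r.1 r.2 (-h)) t) ∧
        WaterWave.SecondEq h φ η (WaterWave.sDt (WaterWave.surfPot φ η)) ψ t ∧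
        WaterWave.SecondEq h φ η (WaterWave.localRhs g (WaterWave.surfPot φ η) η) ψ t) ∧
    -- the local equation
    (∀ t ∈ T, ∀ x y, WaterWave.sDt (WaterWave.surfPot φ η) t x y
      = WaterWave.localRhs g (WaterWave.surfPot φ η) η t x y) ∧
    -- the nonlocal equation is the first integral equation for a special test function
    (∀ k l : ℝ,
      WaterWave.IsTestFunction (fun _ => 1) h T η (WaterWave.afmTest h k l) ∧
      (∀ x y, WaterWave.Dz (WaterWave.Dz (WaterWave.afmTest h k l)) x y (-h) = 0) ∧
      (∀ t ∈ T, ∀ x y,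
        deriv (fun s => WaterWave.afmTest h k l x y (η s x y)) t
            - WaterWave.tangentialTerm (WaterWave.surfPot φ η t) (η t)
                (WaterWave.afmTest h k l) x y
          = -Complex.I * (WaterWave.waveNumber k l : ℂ)
              * WaterWave.afmIntegrand h (WaterWave.surfPot φ η) η k l t x y) ∧
      (∀ t ∈ T,
        Integrable (fun r : ℝ × ℝ =>
          WaterWave.afmIntegrand h (WaterWave.surfPot φ η) η k l t r.1 r.2) ∧
        ∫ r : ℝ × ℝ,
          WaterWave.afmIntegrand h (WaterWave.surfPot φ η) η k l t r.1 r.2 = 0)) := by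
  have hall : ∀ (G : ℝ × ℝ → ℝ), Integrable (fun r => D r * G r) →
      ∀ ψ : ℝ → ℝ → ℝ → ℂ, WaterWave.IsTestFunction G h T η ψ → ∀ t ∈ T,
        WaterWave.FirstEq h φ η ψ t ∧
        (Integrable (fun r : ℝ × ℝ => ψ r.1 r.2 (η t r.1 r.2)) →
          HasDerivAt (fun s => ∫ r : ℝ × ℝ, ψ r.1 r.2 (η s r.1 r.2))
            ((∫ r : ℝ × ℝ,
                WaterWave.tangentialTerm (WaterWave.surfPot φ η t) (η t) ψ r.1 r.2)
              - ∫ r : ℝ × ℝ, (φ t r.1 r.2 (-h) : ℂ)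
                  * WaterWave.Dz (WaterWave.Dz ψ) r.1 r.2 (-h)) t) ∧
        WaterWave.SecondEq h φ η (WaterWave.sDt (WaterWave.surfPot φ η)) ψ t ∧
        WaterWave.SecondEq h φ η (WaterWave.localRhs g (WaterWave.surfPot φ η) η) ψ t := by
    intro G hG ψ hψ t ht
    obtain ⟨U, htU, -, hf, htest⟩ := WaterWave.exists_flow_test hT hsol hD hdecay hψ ht
    have hDG : Integrable fun r => D r * |G r| := by
      refine hG.abs.congr (.of_forall fun r => ?_)
      simp only [abs_mul, abs_of_nonneg (hD.nonneg r)]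
    have hfirst := hf.firstEq htest hDG htU
    refine ⟨hfirst, fun hi => ?_, hf.secondEq htest hDG htU fun _ _ => rfl,
      hf.secondEq htest hDG htU fun x y => (hsol.localEq ht x y).symm⟩
    rw [← hfirst.2.2.2]
    exact hf.hasDerivAt_integral_comp_elevation htest hDG htU hi
  have hone : Integrable fun r => D r * (fun _ : ℝ × ℝ => (1 : ℝ)) r := by
    simpa only [mul_one] using hD.integrable
  refine ⟨hall, fun t ht => hsol.localEq ht, fun k l => ?_⟩
  have hafm := WaterWave.isTestFunction_afmTest (h := h) k l hD hdecay
  refine ⟨hafm, fun x y => ?_, fun t ht => WaterWave.afm_identity k l hsol ht, fun t ht => ?_⟩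
  · rw [WaterWave.Dz_Dz_afmTest, WaterWave.afmTest]
    simp
  · exact WaterWave.nonlocalEq k l hsol ht (hall _ hone _ hafm t ht).1
      (hall _ hone _ (WaterWave.isTestFunction_height hD hdecay) t ht).1
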